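/- For positive integers $m,n$, norms $\|\cdot\|$ on $\mathbb{R}^n$ and $\mathbb{R}^m$, and $c>0$, let $$\mathrm{Bad}_{m,n}(c)=\{A\in M_{m\times n}(\mathbb{R}) : \|\mathbf q\|^n\,\|A\mathbf q-\mathbf p\|^m\ge c \text{ for all } \mathbf q\in\mathbb{Z}^n\setminus\{0\} \text{ and } \mathbf p\in\mathbb{Z}^m\},$$ and for $S\subset M_{m\times n}(\mathbb{R})\cong\mathbb{R}^{mn}$ write $\operatorname{codim}(S)=mn-\dim S$, where $\dim$ is the Hausdorff dimension (with $\dim\varnothing=0$). Theorem. For all positive integers $m,n$ there is $p=p(m,n)>0$, depending only on $m$ and $n$, such that for every choice of norms on $\mathbb{R}^n$ and $\mathbb{R}^m$ there is $k_1>0$, depending only on $m$, $n$ and the chosen norms (so only on $m,n$ for the supremum norms), such that $$\operatorname{codim}\big(\mathrm{Bad}_{m,n}(c)\big)\le k_1\,\frac{c^{1/p}}{\log(1/c)}\qquad\text{for all } 0<c<1.$$ Moreover, one can take $p(m,1)=2m$ for all $m\ge 1$ and $p(1,n)=2n^2$ for all $n\ge 1$. -/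

import Mathlib

open scoped Matrix Matrix.Norms.Elementwise

/-- A seminorm that separates points, i.e. a norm on the real vector space `E`. -/
def IsNorm {E : Type*} [AddCommGroup E] [Module ℝ E] (N : Seminorm ℝ E) : Prop :=
  ∀ x : E, N x = 0 → x = 0

/-- The set of `m × n` real matrices `A` with `‖q‖ ^ n * ‖A q - p‖ ^ m ≥ c` for all nonzero
`q ∈ ℤⁿ` and all `p ∈ ℤᵐ`, where the norm on `ℝⁿ` is `N` and the norm on `ℝᵐ` is `M`. -/
def Bad (m n : ℕ) (N : Seminorm ℝ (Fin n → ℝ)) (M : Seminorm ℝ (Fin m → ℝ)) (c : ℝ) :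
    Set (Matrix (Fin m) (Fin n) ℝ) :=
  {A | ∀ q : Fin n → ℤ, q ≠ 0 → ∀ p : Fin m → ℤ,
    c ≤ N (fun j => (q j : ℝ)) ^ n *
      M (A *ᵥ (fun j => (q j : ℝ)) - fun i => (p i : ℝ)) ^ m}

/-- The Hausdorff codimension of a subset of a finite-dimensional real normed space
(where every subset has finite Hausdorff dimension, and where the dimension does not depend on
the norm). -/
noncomputable def hausdorffCodim {E : Type*} [NormedAddCommGroup E] [NormedSpace ℝ E]
    (S : Set E) : ℝ :=
  (Module.finrank ℝ E : ℝ) - (dimH S).toReal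

open MeasureTheory Set

/-! The codimension is bounded by building, for each large integer `b`, a Cantor-like subset of the
badly approximable matrices with constant about `b ^ (-e)`. Cubes are subdivided repeatedly, and
those children on which some integer vector approximates too well are discarded. If each surviving
cube loses at most a proportion `C / b` of its children, the mass distribution principle gives
codimension at most of order `1 / (b log b)` (`le_dimH_of_sparse_tree`). Taking `b` of order `c ^
(-1 / e)` turns this into the claimed bound, so `e` is the exponent `p`.

For a single column (`n = 1`) the rationals that newly threaten one cube have comparable
denominators, and the simplex lemma puts them all on one hyperplane. The bad children hug that
hyperplane and number `O(b ^ (m - 1))` out of `b ^ m`. The constant is `b ^ (-2m)`, so `p = 2m`.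

For a single row (`m = 1`) Khintchine's transference principle sends the column set with constant
`c` into the row set with constant of order `c ^ n`, which turns `2n` into `2n ^ 2`.

In general one follows the lattices of vectors `(U ^ (-k) q, W ^ k (A q - p))` with `W ^ m = U ^ n`
(Dani correspondence), and a cube is kept while these have no nonzero vector shorter than `1 / b`.
Such a lattice has covering radius polynomial in `b`, hence boundedly many vectors of given length,
and each vector spoils few children. With `U` and `W` high powers of `b`, the total loss is still
`O(1 / b)`. -/

/-! ### Dimension of limit sets of trees of cubes. -/

/-- Mass distribution principle for a coding of a set by sequences over an alphabet of `N`
letters: if sets of diameter at most `b ^ (-k)` see at most `C` prefixes of length `k`, then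
the coded set has dimension at least `log N / log b`. -/
theorem le_dimH_range_of_coding {X : Type*} [EMetricSpace X] {b N C : ℕ} (hb : 2 ≤ b)
    (hN : 2 ≤ N) (x : (ℕ → Fin N) → X)
    (h : ∀ (k : ℕ) (U : Set X), Metric.ediam U ≤ ((b : ENNReal) ^ k)⁻¹ →
      ∃ F : Finset (Fin k → Fin N), F.card ≤ C ∧ ∀ ω, x ω ∈ U → (fun i : Fin k => ω i) ∈ F) :
    ENNReal.ofReal (Real.log N / Real.log b) ≤ dimH (range x) := by
  borelize X
  have : NeZero N := ⟨by omega⟩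
  set s : ℝ := Real.log N / Real.log b with hs
  have hlogb : 0 < Real.log b := Real.log_pos (by exact_mod_cast hb)
  have hs0 : 0 < s := div_pos (Real.log_pos (by exact_mod_cast hN)) hlogb
  let P : Measure (ℕ → Fin N) :=
    Measure.infinitePi fun _ => ProbabilityTheory.uniformOn (univ : Set (Fin N))
  have hsing : ∀ j : Fin N,
      ProbabilityTheory.uniformOn (univ : Set (Fin N)) {j} = (N : ENNReal)⁻¹ := by
    intro j
    rw [ProbabilityTheory.uniformOn_univ]
    simp
  have hcyl : ∀ (k : ℕ) (v : Fin k → Fin N),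
      P {ω | (fun i : Fin k => ω i) = v} = ((N : ENNReal) ^ k)⁻¹ := by
    intro k v
    have : {ω : ℕ → Fin N | (fun i : Fin k => ω i) = v} =
        ((Finset.range k : Finset ℕ) : Set ℕ).pi
          fun i => if hi : i < k then {v ⟨i, hi⟩} else univ := by
      ext ω
      simp only [mem_ofPred_eq, Set.mem_pi, Finset.coe_range, mem_Iio, funext_iff]
      constructor
      · intro hω i hi
        simp [hi, hω ⟨i, hi⟩]
      · intro hω i
        have := hω i i.2
        simpa using this
    rw [this, Measure.infinitePi_pi]
    · have : ∀ i ∈ Finset.range k, ProbabilityTheory.uniformOn (univ : Set (Fin N))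
          (if hi : i < k then {v ⟨i, hi⟩} else univ) = (N : ENNReal)⁻¹ := by
        intro i hi
        simp [Finset.mem_range.1 hi, hsing]
      rw [Finset.prod_congr rfl this, Finset.prod_const, Finset.card_range, ENNReal.inv_pow]
    · intro i _
      exact MeasurableSet.of_discrete
  have hprefix : ∀ (k : ℕ) (U : Set X), Metric.ediam U ≤ ((b : ENNReal) ^ k)⁻¹ →
      P (x ⁻¹' U) ≤ C * ((N : ENNReal) ^ k)⁻¹ := by
    intro k U hU
    obtain ⟨F, hF, hFU⟩ := h k U hU
    calc P (x ⁻¹' U) ≤ P (⋃ v ∈ F, {ω | (fun i : Fin k => ω i) = v}) := by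
          apply measure_mono
          intro ω hω
          simpa using hFU ω hω
      _ ≤ ∑ v ∈ F, P {ω | (fun i : Fin k => ω i) = v} := measure_biUnion_finset_le _ _
      _ = F.card * ((N : ENNReal) ^ k)⁻¹ := by simp [hcyl]
      _ ≤ C * ((N : ENNReal) ^ k)⁻¹ := by gcongr
  have hNtop : (N : ENNReal) ≠ ⊤ := ENNReal.natCast_ne_top N
  have hN0 : (N : ENNReal) ≠ 0 := by exact_mod_cast (by omega : N ≠ 0)
  have htend : ∀ a : ℕ, 2 ≤ a →
      Filter.Tendsto (fun k : ℕ => ((a : ENNReal) ^ k)⁻¹) Filter.atTop (nhds 0) := by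
    intro a ha
    simp_rw [ENNReal.inv_pow]
    apply ENNReal.tendsto_pow_atTop_nhds_zero_of_lt_one
    exact ENNReal.inv_lt_one.2 (by exact_mod_cast (by omega : 1 < a))
  have hNs : ∀ k : ℕ, ((N : ENNReal) ^ k)⁻¹ = (((b : ENNReal) ^ k)⁻¹) ^ s := by
    intro k
    have h1 : (b : ENNReal) ^ s = N := by
      have hb0 : (0 : ℝ) < b := by exact_mod_cast (by omega : 0 < b)
      have : (b : ℝ) ^ s = N := by
        rw [Real.rpow_def_of_pos hb0, hs, mul_div_cancel₀ _ hlogb.ne',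
          Real.exp_log (by exact_mod_cast (by omega : 0 < N))]
      rw [← ENNReal.ofReal_natCast b, ENNReal.ofReal_rpow_of_pos hb0, this,
        ENNReal.ofReal_natCast]
    rw [ENNReal.inv_rpow, ← h1, ← ENNReal.rpow_natCast, ← ENNReal.rpow_natCast,
      ← ENNReal.rpow_mul, ← ENNReal.rpow_mul, mul_comm]
  have hmain : ∀ U : Set X, Metric.ediam U ≤ 1 →
      P (x ⁻¹' U) ≤ (C * N : ENNReal) * (Metric.ediam U) ^ s := by
    intro U hU
    by_cases h0 : Metric.ediam U = 0
    · have hz : P (x ⁻¹' U) ≤ C * 0 := by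
        refine ge_of_tendsto' (ENNReal.Tendsto.const_mul (htend N hN)
          (Or.inr (ENNReal.natCast_ne_top C))) fun k => hprefix k U (by simp [h0])
      rw [mul_zero] at hz
      exact hz.trans zero_le
    -- With `k + 1` the least exponent for which `b ^ (-(k + 1))` is below the diameter, the prefix
    -- bound applies at level `k`. Comparing with level `k + 1` costs the factor `N` in the
    -- constant.
    · have hex : ∃ k : ℕ, ((b : ENNReal) ^ k)⁻¹ < Metric.ediam U :=
        ((htend b hb).eventually (gt_mem_nhds (pos_iff_ne_zero.2 h0))).exists
      classical
      have hk := Nat.find_spec hex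
      obtain ⟨k, hk'⟩ : ∃ k, Nat.find hex = k + 1 := by
        refine Nat.exists_eq_succ_of_ne_zero fun hz => ?_
        rw [hz] at hk
        simp at hk
        exact absurd hU (not_le.2 hk)
      have hk2 := Nat.find_min hex (m := k) (by omega)
      rw [hk'] at hk
      calc P (x ⁻¹' U) ≤ C * ((N : ENNReal) ^ k)⁻¹ := hprefix k U (not_lt.1 hk2)
        _ = C * N * ((N : ENNReal) ^ (k + 1))⁻¹ := by
          rw [pow_succ, ENNReal.mul_inv (Or.inr hNtop) (Or.inr hN0), mul_assoc,
            mul_comm (((N : ENNReal) ^ k)⁻¹), ← mul_assoc (N : ENNReal),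
            ENNReal.mul_inv_cancel hN0 hNtop, one_mul]
        _ = C * N * (((b : ENNReal) ^ (k + 1))⁻¹) ^ s := by rw [hNs]
        _ ≤ C * N * (Metric.ediam U) ^ s := by gcongr
  -- Pushing forward as an outer measure avoids any measurability requirement on `x`.
  have hle : OuterMeasure.map x P.toOuterMeasure ≤
      OuterMeasure.mkMetric ((C * N : ENNReal) • fun r : ENNReal => r ^ s) :=
    OuterMeasure.le_mkMetric _ _ 1 one_pos fun U hU => by simpa using hmain U hU
  have hle' : (1 : ENNReal) ≤ (C * N : ENNReal) * Measure.hausdorffMeasure s (range x) := by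
    have h1 := hle (range x)
    rw [OuterMeasure.mkMetric_smul _ (ENNReal.mul_ne_top (ENNReal.natCast_ne_top C) hNtop)] at h1
    · have h2 : P (x ⁻¹' range x) = 1 := by simp [P]
      rw [OuterMeasure.map_apply] at h1
      simp only [smul_apply, OuterMeasure.coe_mkMetric, smul_eq_mul] at h1
      exact h2.symm.le.trans h1
    -- The constant `C` is nonzero, because the family for a one-point set at level 0 contains the
    -- empty prefix.
    · obtain ⟨F, hF, hFU⟩ := h 0 {x fun _ => 0} (by simp)
      have : F.card ≠ 0 := (Finset.card_pos.2 ⟨_, hFU (fun _ => 0) rfl⟩).ne'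
      exact mul_ne_zero (by exact_mod_cast (by omega : C ≠ 0)) hN0
  have hne : Measure.hausdorffMeasure s (range x) ≠ 0 := by
    intro h0
    rw [h0, mul_zero] at hle'
    exact absurd hle' (by simp)
  have := le_dimH_of_hausdorffMeasure_ne_zero (s := range x) (d := s.toNNReal)
    (by rwa [Real.coe_toNNReal _ hs0.le])
  exact this

/-- The closed `b`-adic cube of side `b ^ (-k)` with corner `b ^ (-k) z`. -/
def adicCube {ι : Type*} (b k : ℕ) (z : ι → ℤ) : Set (ι → ℝ) :=
  {x | ∀ i, (z i : ℝ) ≤ (b : ℝ) ^ k * x i ∧ (b : ℝ) ^ k * x i ≤ z i + 1}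

/-- The `b`-adic subcube with digits `a`. -/
def adicChild {ι : Type*} {b : ℕ} (z : ι → ℤ) (a : ι → Fin b) : ι → ℤ :=
  fun i => (b : ℤ) * z i + ((a i : ℕ) : ℤ)

theorem adicChild_injective {ι : Type*} {b : ℕ} {z z' : ι → ℤ} {a a' : ι → Fin b}
    (h : adicChild z a = adicChild z' a') : z = z' ∧ a = a' := by
  have key : ∀ i, z i = z' i ∧ a i = a' i := by
    intro i
    have h1 : (b : ℤ) * z i + ((a i : ℕ) : ℤ) = (b : ℤ) * z' i + ((a' i : ℕ) : ℤ) := congrFun h i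
    have ha := (a i).2
    have ha' := (a' i).2
    have hb : (0 : ℤ) < b := by exact_mod_cast (by omega : 0 < b)
    have e1 : ((b : ℤ) * z i + ((a i : ℕ) : ℤ)) / b =
        ((b : ℤ) * z' i + ((a' i : ℕ) : ℤ)) / b := by rw [h1]
    rw [add_comm, Int.add_mul_ediv_left _ _ hb.ne', add_comm ((b : ℤ) * z' i),
      Int.add_mul_ediv_left _ _ hb.ne', Int.ediv_eq_zero_of_lt (by positivity)
      (by exact_mod_cast ha), Int.ediv_eq_zero_of_lt (by positivity) (by exact_mod_cast ha'),
      zero_add, zero_add] at e1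
    refine ⟨e1, Fin.ext ?_⟩
    rw [e1] at h1
    have := add_left_cancel h1
    exact_mod_cast this
  exact ⟨funext fun i => (key i).1, funext fun i => (key i).2⟩

theorem adicCube_child_subset {ι : Type*} {b k : ℕ} (z : ι → ℤ) (a : ι → Fin b) :
    adicCube b (k + 1) (adicChild z a) ⊆ adicCube b k z := by
  intro x hx i
  obtain ⟨h1, h2⟩ := hx i
  have ha := (a i).2
  have hb : (0 : ℝ) < b := by exact_mod_cast (by omega : 0 < b)
  have ha' : ((a i : ℕ) : ℝ) + 1 ≤ b := by exact_mod_cast ha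
  simp only [adicChild, Int.cast_add, Int.cast_mul, Int.cast_natCast] at h1 h2
  have e : (b : ℝ) ^ (k + 1) * x i = b * (b ^ k * x i) := by ring
  rw [e] at h1 h2
  have ha0 : (0 : ℝ) ≤ ((a i : ℕ) : ℝ) := by positivity
  constructor
  · refine le_of_mul_le_mul_left ?_ hb
    linarith
  · refine le_of_mul_le_mul_left ?_ hb
    linarith

theorem adicCube_eq_Icc {ι : Type*} {b k : ℕ} (hb : 0 < b) (z : ι → ℤ) :
    adicCube b k z = Icc (fun i => (z i : ℝ) / b ^ k) (fun i => ((z i : ℝ) + 1) / b ^ k) := by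
  have hb : (0 : ℝ) < (b : ℝ) ^ k := by positivity
  ext x
  simp only [adicCube, mem_ofPred_eq, mem_Icc, Pi.le_def, div_le_iff₀ hb, le_div_iff₀ hb,
    mul_comm (x _), forall_and]

open Classical in
/-- A tree of `b`-adic cubes in which every node has at least `N` children has a limit set of
dimension at least `log N / log b`. -/
theorem le_dimH_of_adic_tree {ι : Type*} [Fintype ι] [DecidableEq ι] {b N : ℕ} (hb : 2 ≤ b) (hN : 2 ≤ N)
    (G : ℕ → (ι → ℤ) → Prop) (z₀ : ι → ℤ) (h₀ : G 0 z₀)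
    (hG : ∀ k z, G k z →
      N ≤ (Finset.univ.filter fun a : ι → Fin b => G (k + 1) (adicChild z a)).card) :
    ENNReal.ofReal (Real.log N / Real.log b) ≤
      dimH {x : ι → ℝ | ∀ k, ∃ z, G k z ∧ x ∈ adicCube b k z} := by
  have : NeZero N := ⟨by omega⟩
  have hsel : ∀ (k : ℕ) (s : {z // G k z}), ∃ f : Fin N → (ι → Fin b), Function.Injective f ∧
      ∀ j, G (k + 1) (adicChild s.1 (f j)) := by
    intro k s
    have h1 : Fintype.card (Fin N) ≤
        Fintype.card {a : ι → Fin b // G (k + 1) (adicChild s.1 a)} := by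
      rw [Fintype.card_fin, Fintype.card_subtype]
      exact hG k s.1 s.2
    obtain ⟨f⟩ := Function.Embedding.nonempty_of_card_le h1
    exact ⟨fun j => (f j).1, fun i j hij => f.injective (Subtype.ext hij), fun j => (f j).2⟩
  choose f hfinj hfG using hsel
  let T : (ℕ → Fin N) → ∀ k, {z // G k z} := fun ω k =>
    Nat.rec (motive := fun k => {z // G k z}) ⟨z₀, h₀⟩
      (fun k s => ⟨adicChild s.1 (f k s (ω k)), hfG k s (ω k)⟩) k
  have hTsucc : ∀ ω k, (T ω (k + 1)).1 = adicChild (T ω k).1 (f k (T ω k) (ω k)) :=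
    fun ω k => rfl
  have hpt : ∀ ω, ∃ x : ι → ℝ, ∀ k, x ∈ adicCube b k (T ω k).1 := by
    intro ω
    have := IsCompact.nonempty_iInter_of_sequence_nonempty_isCompact_isClosed
      (fun k => adicCube b k (T ω k).1)
      (fun k => by rw [hTsucc]; exact adicCube_child_subset _ _)
      (fun k => by
        rw [adicCube_eq_Icc (by omega)]
        refine nonempty_Icc.2 fun i => ?_
        have : (0 : ℝ) < (b : ℝ) ^ k := pow_pos (by exact_mod_cast (by omega : 0 < b)) _
        beta_reduce
        gcongr
        linarith)
      (by rw [adicCube_eq_Icc (by omega)]; exact isCompact_Icc)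
      (fun k => by rw [adicCube_eq_Icc (by omega)]; exact isClosed_Icc)
    obtain ⟨x, hx⟩ := this
    exact ⟨x, fun k => mem_iInter.1 hx k⟩
  choose x hx using hpt
  have hdet : ∀ (k : ℕ) (ω ω' : ℕ → Fin N), (T ω k).1 = (T ω' k).1 → ∀ i < k, ω i = ω' i := by
    intro k
    induction k with
    | zero => intro _ _ _ i hi; omega
    | succ k ih =>
      intro ω ω' h i hi
      rw [hTsucc, hTsucc] at h
      obtain ⟨h1, h2⟩ := adicChild_injective h
      have h3 : T ω k = T ω' k := Subtype.ext h1
      rcases Nat.lt_succ_iff_lt_or_eq.1 hi with hi | rfl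
      · exact ih ω ω' h1 i hi
      · rw [h3] at h2
        exact hfinj _ _ h2
  refine (le_dimH_range_of_coding (C := 4 ^ Fintype.card ι) hb hN x ?_).trans
    (dimH_mono ?_)
  · intro k U hU
    let W : Set (ℕ → Fin N) := x ⁻¹' U
    let S : Set (Fin k → Fin N) := (fun ω => fun i : Fin k => ω i) '' W
    refine ⟨S.toFinset, ?_, fun ω hω => by
      simp only [S, W, mem_toFinset]; exact ⟨ω, hω, rfl⟩⟩
    rcases S.eq_empty_or_nonempty with hS | hS
    · simp [hS]
    obtain ⟨_, ω₀, hω₀, _⟩ := hS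
    have hbk : (0 : ℝ) < (b : ℝ) ^ k := pow_pos (by exact_mod_cast (by omega : 0 < b)) _
    -- If `t` lies in `[z, z + 1]` and within 1 of `t₀`, then `t₀ - 2 ≤ z ≤ t₀ + 1`, which leaves
    -- four integers per coordinate. By `hdet` the corner of the cube recovers the prefix, so `4 ^
    -- card ι` also bounds the prefixes.
    let Z : Finset (ι → ℤ) := Fintype.piFinset fun i =>
      Finset.Icc (⌈(b : ℝ) ^ k * x ω₀ i⌉ - 2) (⌈(b : ℝ) ^ k * x ω₀ i⌉ + 1)
    have hZ : ∀ ω ∈ W, (T ω k).1 ∈ Z := by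
      intro ω hω
      refine Fintype.mem_piFinset.2 fun i => ?_
      have hd : dist (x ω) (x ω₀) ≤ ((b : ℝ) ^ k)⁻¹ := by
        have h1 : edist (x ω) (x ω₀) ≤ ((b : ENNReal) ^ k)⁻¹ :=
          (Metric.edist_le_ediam_of_mem (show x ω ∈ U from hω) hω₀).trans hU
        rw [edist_dist] at h1
        have h2 : ((b : ENNReal) ^ k)⁻¹ = ENNReal.ofReal (((b : ℝ) ^ k)⁻¹) := by
          rw [ENNReal.ofReal_inv_of_pos hbk, ENNReal.ofReal_pow (by positivity),
            ENNReal.ofReal_natCast]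
        rw [h2] at h1
        exact (ENNReal.ofReal_le_ofReal_iff (by positivity)).1 h1
      have hd' : |x ω i - x ω₀ i| ≤ ((b : ℝ) ^ k)⁻¹ := by
        rw [← Real.dist_eq]; exact (dist_le_pi_dist _ _ i).trans hd
      have h3 : |(b : ℝ) ^ k * x ω i - (b : ℝ) ^ k * x ω₀ i| ≤ 1 := by
        rw [← mul_sub, abs_mul, abs_of_pos hbk]
        calc _ ≤ (b : ℝ) ^ k * ((b : ℝ) ^ k)⁻¹ := by gcongr
          _ = 1 := mul_inv_cancel₀ hbk.ne'
      obtain ⟨h4, h5⟩ := hx ω k i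
      rw [abs_le] at h3
      have h6 := Int.le_ceil ((b : ℝ) ^ k * x ω₀ i)
      have h7 := Int.ceil_lt_add_one ((b : ℝ) ^ k * x ω₀ i)
      rw [Finset.mem_Icc]
      constructor
      · have : (((⌈(b : ℝ) ^ k * x ω₀ i⌉ : ℤ) : ℝ)) < ((T ω k).1 i : ℝ) + 3 := by linarith
        have : ⌈(b : ℝ) ^ k * x ω₀ i⌉ < (T ω k).1 i + 3 := by exact_mod_cast this
        omega
      · have : ((T ω k).1 i : ℝ) ≤ ((⌈(b : ℝ) ^ k * x ω₀ i⌉ : ℤ) : ℝ) + 1 := by linarith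
        exact_mod_cast this
    have hZcard : Z.card = 4 ^ Fintype.card ι := by
      simp only [Z, Fintype.card_piFinset, Int.card_Icc]
      rw [Finset.prod_congr rfl (g := fun _ => 4)]
      · simp
      · intro i _
        have : (⌈(b : ℝ) ^ k * x ω₀ i⌉ + 1 + 1 - (⌈(b : ℝ) ^ k * x ω₀ i⌉ - 2)) = 4 := by ring
        rw [this]; rfl
    rw [← hZcard]
    have hrep : ∀ v ∈ S.toFinset, ∃ ω ∈ W, (fun i : Fin k => ω i) = v := by
      intro v hv
      simpa [S] using hv
    choose! g hgW hgv using hrep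
    refine Finset.card_le_card_of_injOn (fun v => (T (g v) k).1)
      (fun v hv => hZ _ (hgW v hv)) ?_
    intro v hv v' hv' hvv
    rw [← hgv v hv, ← hgv v' hv']
    funext i
    exact hdet k _ _ hvv i i.2
  · rintro _ ⟨ω, rfl⟩ k
    exact ⟨(T ω k).1, (T ω k).2, hx ω k⟩

/-! ### Geometry of numbers: linear forms, covering radius, lattice point counts. -/

theorem mem_span_basisFun_int {ι : Type*} [Fintype ι] [DecidableEq ι] (v : ι → ℝ) :
    v ∈ Submodule.span ℤ (range (Pi.basisFun ℝ ι)) ↔ ∃ x : ι → ℤ, v = fun i => (x i : ℝ) := by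
  rw [Module.Basis.mem_span_iff_repr_mem]
  simp only [Pi.basisFun_repr]
  constructor
  · intro h
    choose x hx using h
    exact ⟨x, funext fun i => (hx i).symm⟩
  · rintro ⟨x, rfl⟩ i
    exact ⟨x i, rfl⟩

theorem volume_preimage_mulVec {ι : Type*} [Fintype ι] [DecidableEq ι] (M : Matrix ι ι ℝ)
    (hM : M.det ≠ 0) (s : Set (ι → ℝ)) :
    volume ((fun v => M *ᵥ v) ⁻¹' s) = ENNReal.ofReal |M.det⁻¹| * volume s := by
  have := Measure.addHaar_preimage_linearMap (volume : Measure (ι → ℝ)) (f := Matrix.toLin' M)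
    (by rwa [LinearMap.det_toLin']) s
  rw [LinearMap.det_toLin'] at this
  exact this

/-- Minkowski's theorem on linear forms. -/
theorem minkowski_linear_forms {ι : Type*} [Fintype ι] [DecidableEq ι] (M : Matrix ι ι ℝ)
    (hM : M.det ≠ 0) (a : ι → ℝ) (ha : ∀ i, 0 < a i) (hprod : |M.det| < ∏ i, a i) :
    ∃ x : ι → ℤ, x ≠ 0 ∧ ∀ i, |(M *ᵥ fun j => (x j : ℝ)) i| < a i := by
  let L := (Submodule.span ℤ (range (Pi.basisFun ℝ ι))).toAddSubgroup
  let s : Set (ι → ℝ) := (fun v => M *ᵥ v) ⁻¹' (univ.pi fun i => Ioo (-a i) (a i))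
  have hfd : IsAddFundamentalDomain L (ZSpan.fundamentalDomain (Pi.basisFun ℝ ι)) volume :=
    ZSpan.isAddFundamentalDomain (Pi.basisFun ℝ ι) volume
  have : Countable L :=
    inferInstanceAs (Countable (Submodule.span ℤ (range (Pi.basisFun ℝ ι))))
  have hconv : Convex ℝ s :=
    (convex_pi fun i _ => convex_Ioo _ _).linear_preimage (Matrix.toLin' M)
  have hsymm : ∀ x ∈ s, -x ∈ s := by
    intro x hx i hi
    have := hx i hi
    simp only [Matrix.mulVec_neg, Pi.neg_apply, mem_Ioo] at this ⊢
    constructor <;> linarith [this.1, this.2]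
  have hvol : volume (ZSpan.fundamentalDomain (Pi.basisFun ℝ ι)) *
      2 ^ Module.finrank ℝ (ι → ℝ) < volume s := by
    have h1 : volume (ZSpan.fundamentalDomain (Pi.basisFun ℝ ι)) = 1 := by
      simp [ZSpan.fundamentalDomain_pi_basisFun, volume_pi_pi]
    rw [h1, one_mul, volume_preimage_mulVec M hM, volume_pi_pi]
    simp only [Real.volume_Ioo]
    rw [← ENNReal.ofReal_prod_of_nonneg (fun i _ => by linarith [ha i]),
      ← ENNReal.ofReal_mul (abs_nonneg _), Module.finrank_fintype_fun_eq_card]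
    have h2 : (2 : ENNReal) ^ Fintype.card ι = ENNReal.ofReal (2 ^ Fintype.card ι) := by
      rw [ENNReal.ofReal_pow (by norm_num)]; simp
    rw [h2, ENNReal.ofReal_lt_ofReal_iff_of_nonneg (by positivity)]
    have h3 : ∏ i, (a i - -a i) = 2 ^ Fintype.card ι * ∏ i, a i := by
      simp_rw [sub_neg_eq_add, ← two_mul]
      rw [Finset.prod_mul_distrib]; simp
    have hd : 0 < |M.det| := abs_pos.2 hM
    rw [h3, abs_inv, ← mul_assoc, mul_comm _ ((2 : ℝ) ^ _), mul_assoc]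
    refine lt_mul_of_one_lt_right (by positivity) ?_
    rw [inv_mul_eq_div, one_lt_div hd]
    exact hprod
  obtain ⟨x, hx0, hxs⟩ :=
    exists_ne_zero_mem_lattice_of_measure_mul_two_pow_lt_measure hfd hsymm hconv hvol
  obtain ⟨y, hy⟩ := (mem_span_basisFun_int (x : ι → ℝ)).1 x.2
  refine ⟨y, ?_, fun i => ?_⟩
  · rintro rfl
    exact hx0 (Subtype.ext (by rw [hy]; ext; simp))
  · rw [← hy, abs_lt]
    exact hxs i (mem_univ i)

/-- The covering radius of a unimodular lattice is controlled by its shortest vector. -/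
theorem exists_lattice_point_near {ι : Type*} [Fintype ι] [DecidableEq ι] (M : Matrix ι ι ℝ)
    (hM : |M.det| = 1) {ε : ℝ} (hε : 0 < ε)
    (hmin : ∀ x : ι → ℤ, x ≠ 0 → ε ≤ ‖M *ᵥ fun j => (x j : ℝ)‖) (z : ι → ℝ) :
    ∃ x : ι → ℤ, ‖z - M *ᵥ fun j => (x j : ℝ)‖ ≤ (4 / ε) ^ (Fintype.card ι - 1) := by
  rcases isEmpty_or_nonempty ι with hι | hι
  · refine ⟨0, ?_⟩
    have : z - M *ᵥ (fun j => ((0 : ι → ℤ) j : ℝ)) = 0 := Subsingleton.elim _ _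
    rw [this, norm_zero]; positivity
  let V : (ι → ℤ) → (ι → ℝ) := fun x => M *ᵥ fun j => (x j : ℝ)
  have hVadd : ∀ x y, V (x + y) = V x + V y := by
    intro x y
    simp only [V, ← Matrix.mulVec_add]
    congr 1; ext j; simp
  have hVneg : ∀ x, V (-x) = -V x := by
    intro x
    simp only [V, ← Matrix.mulVec_neg]
    congr 1; ext j; simp
  -- A lattice point that is nearest to `z` up to `ε / 4` suffices. If the remainder `w` were too
  -- long, Minkowski would give a nonzero lattice vector in a thin tube around the segment from `-w`
  -- to `w`, and subtracting it would bring the remainder down by at least `ε / 2`.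
  obtain ⟨x₀, hx₀⟩ : ∃ x₀, ∀ x, ‖z - V x₀‖ ≤ ‖z - V x‖ + ε / 4 := by
    have hbdd : BddBelow (range fun x => ‖z - V x‖) := ⟨0, by rintro _ ⟨x, rfl⟩; positivity⟩
    obtain ⟨_, ⟨x₀, rfl⟩, h⟩ := exists_lt_of_csInf_lt (range_nonempty fun x => ‖z - V x‖)
      (lt_add_of_pos_right _ (by positivity : 0 < ε / 4))
    exact ⟨x₀, fun x => h.le.trans (by gcongr; exact csInf_le hbdd ⟨x, rfl⟩)⟩
  refine ⟨x₀, ?_⟩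
  change ‖z - V x₀‖ ≤ _
  by_contra! hbig
  set w := z - V x₀ with hw
  obtain ⟨i₀, hi₀⟩ : ∃ i₀, ‖w‖ = ‖w i₀‖ := by
    obtain ⟨i₀, -, h⟩ := Finset.exists_mem_eq_sup Finset.univ Finset.univ_nonempty
      (fun i => ‖w i‖₊)
    refine ⟨i₀, ?_⟩
    rw [Pi.norm_def, h]; rfl
  have hwpos : 0 < ‖w‖ := lt_of_le_of_lt (by positivity) hbig
  have hwi : w i₀ ≠ 0 := by
    intro h; rw [hi₀, h, norm_zero] at hwpos; exact lt_irrefl _ hwpos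
  -- This shear of determinant 1 measures deviation from the line through `w`: it keeps coordinate
  -- `i₀`, where `w` attains its norm, and subtracts from the others their value along `w`.
  let S : Matrix ι ι ℝ := fun i j =>
    if i = i₀ then (1 : Matrix ι ι ℝ) i j else (1 : Matrix ι ι ℝ) i j - (w i / w i₀) *
      (1 : Matrix ι ι ℝ) i₀ j
  have hSdet : S.det = 1 := by
    rw [← Matrix.det_one (n := ι) (R := ℝ)]
    refine Matrix.det_eq_of_forall_row_eq_smul_add_const
      (fun i => if i = i₀ then 0 else -(w i / w i₀)) i₀ (by simp) ?_
    intro i j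
    by_cases h : i = i₀
    · subst h; simp [S]
    · simp only [S, h, if_false]; ring
  have hSmul : ∀ v i, (S *ᵥ v) i = if i = i₀ then v i else v i - (w i / w i₀) * v i₀ := by
    intro v i
    have h1 : ∀ i, ∑ j, (1 : Matrix ι ι ℝ) i j * v j = v i := by
      intro i
      have := congrFun (Matrix.one_mulVec v) i
      simpa [Matrix.mulVec, dotProduct] using this
    by_cases h : i = i₀
    · simp only [Matrix.mulVec, dotProduct, S, h, if_true]; rw [h1]
    · simp only [Matrix.mulVec, dotProduct, S, h, if_false, sub_mul, Finset.sum_sub_distrib,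
        mul_assoc, ← Finset.mul_sum, h1]
  obtain ⟨x, hx0, hx⟩ := minkowski_linear_forms (S * M)
    (by rw [Matrix.det_mul, hSdet, one_mul]; intro h; rw [h] at hM; simp at hM)
    (fun i => if i = i₀ then ‖w‖ else ε / 4) (fun i => by split_ifs <;> positivity)
    (by
      rw [Matrix.det_mul, hSdet, one_mul, hM, ← Finset.mul_prod_erase _ _ (Finset.mem_univ i₀),
        if_pos rfl, Finset.prod_congr rfl (g := fun _ => ε / 4)
          (fun i hi => if_neg (Finset.ne_of_mem_erase hi)), Finset.prod_const,
        Finset.card_erase_of_mem (Finset.mem_univ _), Finset.card_univ]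
      calc (1 : ℝ) = (4 / ε) ^ (Fintype.card ι - 1) * (ε / 4) ^ (Fintype.card ι - 1) := by
            rw [← mul_pow]; field_simp; simp
        _ < _ := by gcongr)
  have hx' : ∀ i, if i = i₀ then |V x i| < ‖w‖ else |V x i - (w i / w i₀) * V x i₀| < ε / 4 := by
    intro i
    have h := hx i
    rw [← Matrix.mulVec_mulVec, hSmul] at h
    by_cases hi : i = i₀
    · simpa only [hi, if_true] using h
    · simpa only [hi, if_false] using h
  clear hx
  -- Up to sign, the lattice vector is within `ε / 4` of `t • w` with `0 ≤ t ≤ 1`. Near-minimality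
  -- forces `t ‖w‖ ≤ ε / 2`, while the shortest vector bound forces `t ‖w‖ ≥ 3 ε / 4`.
  wlog ht : 0 ≤ V x i₀ / w i₀ generalizing x
  · refine this (-x) (neg_ne_zero.2 hx0) (fun i => ?_) ?_
    · have := hx' i
      rw [hVneg]
      by_cases hi : i = i₀
      · simp only [hi, if_true, Pi.neg_apply, abs_neg] at this ⊢; exact this
      · simp only [hi, if_false, Pi.neg_apply] at this ⊢
        rw [← abs_neg]; convert this using 2; ring
    · rw [hVneg, Pi.neg_apply, neg_div]; linarith [not_le.1 ht]
  set t := V x i₀ / w i₀ with htdef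
  have ht1 : t ≤ 1 := by
    have h := hx' i₀
    simp only [if_true] at h
    rw [hi₀, Real.norm_eq_abs] at h
    have : |t| ≤ 1 := by
      rw [htdef, abs_div]; exact (div_le_one (abs_pos.2 hwi)).2 h.le
    exact (abs_le.1 this).2
  have hclose : ‖V x - t • w‖ ≤ ε / 4 := by
    refine (pi_norm_le_iff_of_nonneg (by positivity)).2 fun i => ?_
    have h := hx' i
    by_cases hi : i = i₀
    · subst hi
      have : (V x - t • w) i = 0 := by
        simp only [Pi.sub_apply, Pi.smul_apply, smul_eq_mul, htdef]; field_simp; simp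
      rw [this, norm_zero]; positivity
    · simp only [hi, if_false] at h
      rw [Real.norm_eq_abs]
      refine (le_of_eq ?_).trans h.le
      simp only [Pi.sub_apply, Pi.smul_apply, smul_eq_mul, htdef]
      congr 1; ring
  have h1 := hx₀ (x₀ + x)
  rw [hVadd, ← sub_sub, ← hw] at h1
  have h2 : ‖w - V x‖ ≤ (1 - t) * ‖w‖ + ε / 4 := by
    calc ‖w - V x‖ = ‖(1 - t) • w - (V x - t • w)‖ := by congr 1; module
      _ ≤ ‖(1 - t) • w‖ + ‖V x - t • w‖ := norm_sub_le _ _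
      _ ≤ _ := by
        rw [norm_smul, Real.norm_eq_abs, abs_of_nonneg (by linarith)]; gcongr
  have h3 : ‖V x‖ ≤ t * ‖w‖ + ε / 4 := by
    calc ‖V x‖ = ‖t • w + (V x - t • w)‖ := by congr 1; module
      _ ≤ ‖t • w‖ + ‖V x - t • w‖ := norm_add_le _ _
      _ ≤ _ := by
        rw [norm_smul, Real.norm_eq_abs, abs_of_nonneg ht]; gcongr
  have h4 := hmin x hx0
  change ε ≤ ‖V x‖ at h4
  linarith

/-- If every point is within `D` of a unimodular lattice, then a ball of radius `Y` has at most
`(2 (Y + D)) ^ d` lattice points. -/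
theorem card_lattice_points_le {ι : Type*} [Fintype ι] [DecidableEq ι] (M : Matrix ι ι ℝ)
    (hM : |M.det| = 1) {D Y : ℝ} (hD : 0 ≤ D) (hY : 0 ≤ Y)
    (hcov : ∀ z : ι → ℝ, ∃ x : ι → ℤ, ‖z - M *ᵥ fun j => (x j : ℝ)‖ ≤ D)
    (X : Finset (ι → ℤ)) (hX : ∀ x ∈ X, ‖M *ᵥ fun j => (x j : ℝ)‖ ≤ Y) :
    (X.card : ℝ) ≤ (2 * (Y + D)) ^ Fintype.card ι := by
  let L := (Submodule.span ℤ (range (Pi.basisFun ℝ ι))).toAddSubgroup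
  have hfd : IsAddFundamentalDomain L (ZSpan.fundamentalDomain (Pi.basisFun ℝ ι)) volume :=
    ZSpan.isAddFundamentalDomain (Pi.basisFun ℝ ι) volume
  have : Countable L :=
    inferInstanceAs (Countable (Submodule.span ℤ (range (Pi.basisFun ℝ ι))))
  have hMdet : M.det ≠ 0 := by intro h; rw [h] at hM; simp at hM
  let S : Set (ι → ℝ) := (fun v => M *ᵥ v) ⁻¹' (univ.pi fun _ => Icc (-(Y + D)) (Y + D))
  have hSmem : ∀ v, v ∈ S ↔ ‖M *ᵥ v‖ ≤ Y + D := by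
    intro v
    rw [pi_norm_le_iff_of_nonneg (by positivity)]
    simp only [S, mem_preimage, Set.mem_pi, mem_univ, true_implies, mem_Icc, Real.norm_eq_abs,
      abs_le]
  have hmeas : MeasurableSet S := by
    refine MeasurableSet.preimage (MeasurableSet.univ_pi fun _ => measurableSet_Icc) ?_
    exact (Matrix.toLin' M).continuous_of_finiteDimensional.measurable
  have hvol : volume S = ENNReal.ofReal ((2 * (Y + D)) ^ Fintype.card ι) := by
    rw [volume_preimage_mulVec M hMdet, abs_inv, hM, volume_pi_pi]
    simp only [Real.volume_Icc, Finset.prod_const, Finset.card_univ, inv_one, ENNReal.ofReal_one,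
      one_mul]
    rw [← ENNReal.ofReal_pow (by linarith)]
    congr 2; ring
  let ofZ : (ι → ℤ) → L := fun x =>
    ⟨fun i => (x i : ℝ), (mem_span_basisFun_int _).2 ⟨x, rfl⟩⟩
  have hofZ : Function.Injective ofZ := by
    intro x y h
    have h1 : (fun i => (x i : ℝ)) = fun i => (y i : ℝ) := congrArg Subtype.val h
    funext i
    exact_mod_cast congrFun h1 i
  -- Averaging argument: translating `X` by minus a lattice point near `M u` shows that every coset
  -- of the lattice has at least `X.card` points in `S`. Integrating over a fundamental domain of
  -- volume 1 bounds `X.card` by the volume of `S`.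
  have hpoint : ∀ u : ι → ℝ, (X.card : ENNReal) ≤
      ∑' g : L, S.indicator (fun _ => (1 : ENNReal)) (g +ᵥ u) := by
    intro u
    obtain ⟨y, hy⟩ := hcov (M *ᵥ u)
    have hinj : Function.Injective fun x : ι → ℤ => ofZ (x - y) :=
      hofZ.comp (sub_left_injective)
    calc (X.card : ENNReal) = ∑ g ∈ X.map ⟨_, hinj⟩, 1 := by simp
      _ ≤ ∑ g ∈ X.map ⟨_, hinj⟩, S.indicator (fun _ => (1 : ENNReal)) (g +ᵥ u) := by
        refine Finset.sum_le_sum fun g hg => ?_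
        obtain ⟨x, hx, rfl⟩ := Finset.mem_map.1 hg
        have : (ofZ (x - y) +ᵥ u : ι → ℝ) ∈ S := by
          rw [hSmem]
          have e : (ofZ (x - y) +ᵥ u : ι → ℝ) =
              (fun j => (x j : ℝ)) + (u - fun j => (y j : ℝ)) := by
            ext i
            change ((x - y) i : ℝ) + u i = _
            simp; ring
          rw [e, Matrix.mulVec_add, Matrix.mulVec_sub]
          exact (norm_add_le _ _).trans (add_le_add (hX x hx) hy)
        change 1 ≤ S.indicator (fun _ => (1 : ENNReal)) (ofZ (x - y) +ᵥ u)
        rw [indicator_of_mem this]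
      _ ≤ _ := ENNReal.sum_le_tsum _
  have hF : volume (ZSpan.fundamentalDomain (Pi.basisFun ℝ ι)) = 1 := by
    simp [ZSpan.fundamentalDomain_pi_basisFun, volume_pi_pi]
  have hle : (X.card : ENNReal) ≤ volume S := by
    calc (X.card : ENNReal)
        = ∫⁻ _ in ZSpan.fundamentalDomain (Pi.basisFun ℝ ι), (X.card : ENNReal) := by
          rw [setLIntegral_const, hF, mul_one]
      _ ≤ ∫⁻ u in ZSpan.fundamentalDomain (Pi.basisFun ℝ ι),
            ∑' g : L, S.indicator (fun _ => (1 : ENNReal)) (g +ᵥ u) :=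
          lintegral_mono hpoint
      _ = ∑' g : L, ∫⁻ u in ZSpan.fundamentalDomain (Pi.basisFun ℝ ι),
            S.indicator (fun _ => (1 : ENNReal)) (g +ᵥ u) := by
          refine lintegral_tsum fun g => ?_
          exact ((measurable_const.indicator hmeas).comp (measurable_const_vadd g)).aemeasurable
      _ = ∫⁻ u, S.indicator (fun _ => (1 : ENNReal)) u := (hfd.lintegral_eq_tsum'' _).symm
      _ = volume S := by rw [lintegral_indicator_const hmeas, one_mul]
  rw [hvol, ← ENNReal.ofReal_natCast] at hle
  exact (ENNReal.ofReal_le_ofReal_iff (by positivity)).1 hle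

/-! ### Subcubes near hyperplanes, determinants and sparse trees. -/

theorem card_le_of_pairwise_sub_le {T : Finset ℕ} {l : ℝ} (hl : 0 ≤ l)
    (h : ∀ s ∈ T, ∀ t ∈ T, (t : ℝ) - s ≤ l) : (T.card : ℝ) ≤ l + 1 := by
  rcases T.eq_empty_or_nonempty with rfl | hT
  · simp; linarith
  have h1 : T ⊆ Finset.Icc (T.min' hT) (T.max' hT) := fun t ht =>
    Finset.mem_Icc.2 ⟨T.min'_le t ht, T.le_max' t ht⟩
  have h2 := Finset.card_le_card h1
  rw [Nat.card_Icc] at h2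
  have h3 := T.min'_le _ (T.max'_mem hT)
  have h4 := h _ (T.min'_mem hT) _ (T.max'_mem hT)
  have h5 : (T.card : ℝ) ≤ (T.max' hT : ℝ) + 1 - T.min' hT := by
    rw [le_sub_iff_add_le]
    exact_mod_cast (by omega : T.card + T.min' hT ≤ T.max' hT + 1)
  linarith

open Classical in
/-- The number of digit vectors close to a hyperplane. -/
theorem card_digits_near_hyperplane {κ : Type*} [Fintype κ] [DecidableEq κ] {b : ℕ} (α : κ → ℝ) (j₀ : κ)
    (hα : α j₀ ≠ 0) (γ : ℝ) {R : ℝ} (hR : 0 ≤ R) :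
    ((Finset.univ.filter fun a : κ → Fin b =>
      |∑ j, α j * ((a j : ℕ) : ℝ) + γ| ≤ |α j₀| * R).card : ℝ) ≤
      (b : ℝ) ^ (Fintype.card κ - 1) * (2 * R + 1) := by
  set A := Finset.univ.filter fun a : κ → Fin b =>
      |∑ j, α j * ((a j : ℕ) : ℝ) + γ| ≤ |α j₀| * R with hA
  -- Once all digits except the one at `j₀` are fixed, that digit ranges over an interval of length
  -- `2 * R`.
  let π : (κ → Fin b) → ({j // j ≠ j₀} → Fin b) := fun a j => a j
  have hfib : ∀ v ∈ A.image π, (A.filter fun a => π a = v).card ≤ ⌊2 * R + 1⌋₊ := by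
    intro v _
    apply Nat.le_floor
    have hinj : Set.InjOn (fun a : κ → Fin b => (a j₀ : ℕ)) (A.filter fun a => π a = v) := by
      intro a ha a' ha' h
      simp only [Finset.coe_filter, mem_ofPred_eq] at ha ha'
      funext j
      by_cases hj : j = j₀
      · subst hj; exact Fin.ext h
      · exact congrFun (ha.2.trans ha'.2.symm) ⟨j, hj⟩
    rw [← Finset.card_image_of_injOn hinj]
    refine card_le_of_pairwise_sub_le (by linarith) ?_
    intro s hs t ht
    obtain ⟨a, ha, rfl⟩ := Finset.mem_image.1 hs
    obtain ⟨a', ha', rfl⟩ := Finset.mem_image.1 ht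
    rw [Finset.mem_filter, hA, Finset.mem_filter] at ha ha'
    have hsum : ∑ j, α j * ((a' j : ℕ) : ℝ) - ∑ j, α j * ((a j : ℕ) : ℝ) =
        α j₀ * (((a' j₀ : ℕ) : ℝ) - ((a j₀ : ℕ) : ℝ)) := by
      rw [← Finset.sum_sub_distrib, Finset.sum_eq_single j₀]
      · ring
      · intro j _ hj
        have : a' j = a j := congrFun (ha'.2.trans ha.2.symm) ⟨j, hj⟩
        rw [this, sub_self]
      · simp
    have h1 : |α j₀| * |((a' j₀ : ℕ) : ℝ) - ((a j₀ : ℕ) : ℝ)| ≤ |α j₀| * (2 * R) := by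
      rw [← abs_mul, ← hsum]
      calc _ = |(∑ j, α j * ((a' j : ℕ) : ℝ) + γ) - (∑ j, α j * ((a j : ℕ) : ℝ) + γ)| := by
            congr 1; ring
        _ ≤ _ := abs_sub _ _
        _ ≤ |α j₀| * R + |α j₀| * R := add_le_add ha'.1.2 ha.1.2
        _ = _ := by ring
    exact (le_abs_self _).trans (le_of_mul_le_mul_left h1 (abs_pos.2 hα))
  have h1 := Finset.card_le_mul_card_image (f := π) A ⌊2 * R + 1⌋₊ hfib
  have h2 : (A.image π).card ≤ b ^ (Fintype.card κ - 1) := by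
    refine (Finset.card_le_univ _).trans (le_of_eq ?_)
    rw [Fintype.card_fun, Fintype.card_fin, Fintype.card_subtype_compl]
    simp
  calc (A.card : ℝ) ≤ (⌊2 * R + 1⌋₊ : ℝ) * ((A.image π).card : ℝ) := by exact_mod_cast h1
    _ ≤ (2 * R + 1) * (b : ℝ) ^ (Fintype.card κ - 1) := by
      gcongr
      · exact Nat.floor_le (by positivity)
      · exact_mod_cast h2
    _ = _ := mul_comm _ _

/-- A subcube meeting a neighbourhood of a hyperplane has its digits near a hyperplane. -/
theorem abs_digits_le_of_near_hyperplane {ι κ : Type*} [Fintype κ] {b k : ℕ}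
    (z : ι → ℤ) (a : ι → Fin b) (e : κ → ι) (α : κ → ℝ) (j₀ : κ) (hmax : ∀ j, |α j| ≤ |α j₀|)
    (γ : ℝ) {τ : ℝ} {x : ι → ℝ} (hx : x ∈ adicCube b (k + 1) (adicChild z a))
    (h : |∑ j, α j * x (e j) + γ| ≤ |α j₀| * τ) :
    |∑ j, α j * ((a (e j) : ℕ) : ℝ) + (∑ j, α j * (b * z (e j)) + (b : ℝ) ^ (k + 1) * γ)| ≤
      |α j₀| * ((b : ℝ) ^ (k + 1) * τ + Fintype.card κ) := by
  have h1 : ∑ j, α j * ((a (e j) : ℕ) : ℝ) + (∑ j, α j * (b * z (e j)) + (b : ℝ) ^ (k + 1) * γ) =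
      (b : ℝ) ^ (k + 1) * (∑ j, α j * x (e j) + γ) -
        ∑ j, α j * ((b : ℝ) ^ (k + 1) * x (e j) - (adicChild z a (e j) : ℝ)) := by
    simp only [adicChild, Int.cast_add, Int.cast_mul, Int.cast_natCast]
    rw [mul_add, Finset.mul_sum, ← add_assoc, ← Finset.sum_add_distrib, add_sub_right_comm,
      ← Finset.sum_sub_distrib]
    congr 1
    refine Finset.sum_congr rfl fun j _ => ?_
    ring
  have h2 : |∑ j, α j * ((b : ℝ) ^ (k + 1) * x (e j) - (adicChild z a (e j) : ℝ))| ≤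
      |α j₀| * Fintype.card κ := by
    calc _ ≤ ∑ j, |α j * ((b : ℝ) ^ (k + 1) * x (e j) - (adicChild z a (e j) : ℝ))| :=
          Finset.abs_sum_le_sum_abs _ _
      _ ≤ ∑ _j : κ, |α j₀| := by
        refine Finset.sum_le_sum fun j _ => ?_
        rw [abs_mul]
        obtain ⟨h3, h4⟩ := hx (e j)
        have : |(b : ℝ) ^ (k + 1) * x (e j) - (adicChild z a (e j) : ℝ)| ≤ 1 := by
          rw [abs_le]; constructor <;> linarith
        calc _ ≤ |α j₀| * 1 := mul_le_mul (hmax j) this (abs_nonneg _) (abs_nonneg _)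
          _ = _ := mul_one _
      _ = _ := by simp [mul_comm]
  rw [h1]
  calc _ ≤ _ := abs_sub _ _
    _ ≤ (b : ℝ) ^ (k + 1) * (|α j₀| * τ) + |α j₀| * Fintype.card κ := by
      refine add_le_add ?_ h2
      rw [abs_mul, abs_of_nonneg (by positivity : (0 : ℝ) ≤ (b : ℝ) ^ (k + 1))]
      gcongr
    _ = _ := by ring

theorem exists_max_abs {κ : Type*} [Finite κ] (α : κ → ℝ) (hα : α ≠ 0) :
    ∃ j₀, α j₀ ≠ 0 ∧ ∀ j, |α j| ≤ |α j₀| := by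
  obtain ⟨j, hj⟩ := Function.ne_iff.1 hα
  have : Nonempty κ := ⟨j⟩
  obtain ⟨j₀, hj₀⟩ := Finite.exists_max fun j => |α j|
  refine ⟨j₀, fun h => hj ?_, hj₀⟩
  have := hj₀ j
  rw [h, abs_zero] at this
  exact abs_nonpos_iff.1 this

/-- If all square determinants formed from vectors of `S` vanish, then `S` lies in the kernel of
a nonzero linear form. -/
theorem exists_form_of_det_eq_zero {ι : Type*} [Fintype ι] [DecidableEq ι] (S : Set (ι → ℝ))
    (h : ∀ v : ι → ι → ℝ, (∀ i, v i ∈ S) → (Matrix.of v).det = 0) :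
    ∃ α : ι → ℝ, α ≠ 0 ∧ ∀ v ∈ S, ∑ i, α i * v i = 0 := by
  by_cases htop : Submodule.span ℝ S = ⊤
  · exfalso
    obtain ⟨t, htS, hts, hti⟩ := exists_linearIndependent ℝ S
    rw [htop] at hts
    let B : Module.Basis t ℝ (ι → ℝ) :=
      Module.Basis.mk hti (by rw [Subtype.range_coe, hts])
    have : Fintype t := FiniteDimensional.fintypeBasisIndex B
    have hcard : Fintype.card t = Fintype.card ι := by
      rw [← Module.finrank_eq_card_basis B, Module.finrank_fintype_fun_eq_card]
    let e : ι ≃ t := (Fintype.equivOfCardEq hcard).symm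
    have h1 := h (fun i => (e i : ι → ℝ)) (fun i => htS (e i).2)
    have h2 : LinearIndependent ℝ (fun i => (e i : ι → ℝ)) :=
      hti.comp e e.injective
    have h3 : IsUnit (Matrix.of fun i => (e i : ι → ℝ)) :=
      Matrix.linearIndependent_rows_iff_isUnit.1 h2
    rw [Matrix.isUnit_iff_isUnit_det, h1] at h3
    exact not_isUnit_zero h3
  · obtain ⟨f, hf, hle⟩ := Submodule.exists_le_ker_of_lt_top _ (lt_top_iff_ne_top.2 htop)
    have hfe : ∀ v, f v = ∑ i, f (Pi.single i 1) * v i := by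
      intro v
      rw [LinearMap.pi_apply_eq_sum_univ f v]
      refine Finset.sum_congr rfl fun i _ => ?_
      rw [smul_eq_mul, mul_comm]
      congr 2
      ext j
      simp [Pi.single_apply, eq_comm]
    refine ⟨fun i => f (Pi.single i 1), fun h0 => hf ?_, fun v hv => ?_⟩
    · ext1 i
      ext
      simpa using congrFun h0 i
    · rw [← hfe]
      exact hle (Submodule.subset_span hv)

/-- Each term of the Leibniz expansion uses every row and every column once, so all terms share the
same bound. -/
theorem abs_det_le_of_entry_bounds {ι : Type*} [Fintype ι] [DecidableEq ι] (W : Matrix ι ι ℝ)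
    (r c : ι → ℝ) (h : ∀ i j, |W i j| ≤ r i * c j) :
    |W.det| ≤ (Fintype.card ι).factorial * ((∏ i, r i) * ∏ j, c j) := by
  rw [Matrix.det_apply]
  refine (Finset.abs_sum_le_sum_abs _ _).trans ?_
  calc _ ≤ ∑ _σ : Equiv.Perm ι, (∏ i, r i) * ∏ j, c j := by
        refine Finset.sum_le_sum fun σ _ => ?_
        have : |Equiv.Perm.sign σ • ∏ i, W (σ i) i| = ∏ i, |W (σ i) i| := by
          rw [← Finset.abs_prod]
          rcases Int.units_eq_one_or (Equiv.Perm.sign σ) with h | h <;> simp [h]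
        rw [this, ← Equiv.prod_comp σ r, ← Finset.prod_mul_distrib]
        exact Finset.prod_le_prod (fun _ _ => abs_nonneg _) fun i _ => h _ _
    _ = _ := by simp [Fintype.card_perm]

open Classical in
/-- A tree of cubes in which every node loses at most a proportion `δ` of its children. -/
theorem le_dimH_of_sparse_tree {ι : Type*} [Fintype ι] [DecidableEq ι] [Nonempty ι] {B : ℕ} {δ : ℝ}
    (hB : 4 ≤ B) (hδ0 : 0 ≤ δ) (hδ : δ ≤ 1 / 2)
    (G : ℕ → (ι → ℤ) → Prop) (z₀ : ι → ℤ) (h₀ : G 0 z₀)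
    (hG : ∀ k z, G k z → ((Finset.univ.filter fun a : ι → Fin B =>
      ¬ G (k + 1) (adicChild z a)).card : ℝ) ≤ δ * (B : ℝ) ^ Fintype.card ι) :
    ENNReal.ofReal (Fintype.card ι - 2 * δ / Real.log B) ≤
      dimH {x : ι → ℝ | ∀ k, ∃ z, G k z ∧ x ∈ adicCube B k z} := by
  set D := Fintype.card ι with hD
  have hDpos : 0 < D := Fintype.card_pos
  have hBr : (4 : ℝ) ≤ B := by exact_mod_cast hB
  have hBD : (4 : ℝ) ≤ (B : ℝ) ^ D :=
    hBr.trans (le_self_pow₀ (by linarith) hDpos.ne')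
  set N := ⌈(1 - δ) * (B : ℝ) ^ D⌉₊ with hN
  have hNge : (1 - δ) * (B : ℝ) ^ D ≤ N := Nat.le_ceil _
  have hN2r : (2 : ℝ) ≤ (1 - δ) * (B : ℝ) ^ D := by nlinarith
  have hN2 : 2 ≤ N := by exact_mod_cast hN2r.trans hNge
  refine le_trans (ENNReal.ofReal_le_ofReal ?_)
    (le_dimH_of_adic_tree (by omega : 2 ≤ B) hN2 G z₀ h₀ fun k z hz => ?_)
  · have hlogB : 0 < Real.log B := Real.log_pos (by linarith)
    rw [le_div_iff₀ hlogB, sub_mul, div_mul_cancel₀ _ hlogB.ne']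
    have h1 : Real.log ((1 - δ) * (B : ℝ) ^ D) ≤ Real.log N :=
      Real.log_le_log (by linarith) hNge
    rw [Real.log_mul (by linarith) (by positivity), Real.log_pow] at h1
    -- For `δ ≤ 1 / 2` one has `log (1 - δ) ≥ 1 - (1 - δ)⁻¹ ≥ -2 δ`, the source of the factor 2 in
    -- the dimension loss.
    have h2 := Real.one_sub_inv_le_log_of_pos (by linarith : 0 < 1 - δ)
    have h3 : (1 - δ)⁻¹ ≤ 1 + 2 * δ := by
      rw [inv_le_iff_one_le_mul₀ (by linarith)]; nlinarith
    linarith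
  · rw [hN, Nat.ceil_le]
    have h1 := Finset.card_filter_add_card_filter_not (s := (Finset.univ : Finset (ι → Fin B)))
      (fun a => G (k + 1) (adicChild z a))
    rw [Finset.card_univ, Fintype.card_fun, Fintype.card_fin] at h1
    have h2 : ((Finset.univ.filter fun a : ι → Fin B => G (k + 1) (adicChild z a)).card : ℝ) +
      ((Finset.univ.filter fun a : ι → Fin B => ¬ G (k + 1) (adicChild z a)).card : ℝ) =
        (B : ℝ) ^ D := by exact_mod_cast h1
    have := hG k z hz
    linarith

/-! ### The column case, through the simplex lemma. -/

/-- The vectors `x` with `|q| ‖q x - p‖ ^ m ≥ c` for all nonzero integers `q` and all `p`. -/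
def badVectors (m : ℕ) (c : ℝ) : Set (Fin m → ℝ) :=
  {x | ∀ q : ℤ, q ≠ 0 → ∀ p : Fin m → ℤ,
    c ≤ |(q : ℝ)| * ‖fun i => (q : ℝ) * x i - (p i : ℝ)‖ ^ m}

/-- The simplex lemma: rational points of small denominator in a small cube lie on a common
hyperplane. -/
theorem exists_hyperplane_of_small_denominators {m : ℕ} {θ R : ℝ} (hθ : 0 ≤ θ) (hR : 0 < R)
    (hsmall : (m + 1).factorial * (2 ^ m * θ) < 1) (x₀ : Fin m → ℝ)
    (S : Set (Option (Fin m) → ℤ))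
    (hS : ∀ v ∈ S, |(v none : ℝ)| ^ (m + 1) ≤ θ * R ^ m ∧
      ∀ i, |(v (some i) : ℝ) - v none * x₀ i| ≤ |(v none : ℝ)| * (2 / R)) :
    ∃ α : Option (Fin m) → ℝ, α ≠ 0 ∧ ∀ v ∈ S, ∑ i, α i * (v i : ℝ) = 0 := by
  suffices H : ∀ v : Option (Fin m) → Option (Fin m) → ℝ,
      (∀ i, v i ∈ (fun (v : Option (Fin m) → ℤ) i => (v i : ℝ)) '' S) →
        (Matrix.of v).det = 0 by
    obtain ⟨α, hα, h⟩ := exists_form_of_det_eq_zero _ H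
    exact ⟨α, hα, fun v hv => h _ ⟨v, hv, rfl⟩⟩
  intro v hv
  choose w hwS hwv using hv
  obtain rfl : v = fun i j => (w i j : ℝ) := funext fun i => (hwv i).symm
  let V : Matrix (Option (Fin m)) (Option (Fin m)) ℤ := Matrix.of w
  have hV : Matrix.of (fun i j => (w i j : ℝ)) = V.map (Int.castRingHom ℝ) := by
    ext i j
    rfl
  -- The index `none` carries the denominator. Subtracting multiples of its column leaves the
  -- determinant unchanged and replaces each `p` by the small quantity `p - q x₀`. An integer
  -- determinant of absolute value below 1 then vanishes.
  let W : Matrix (Option (Fin m)) (Option (Fin m)) ℝ := Matrix.of fun i j =>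
    (w i j : ℝ) - (match j with | none => 0 | some j => x₀ j) * w i none
  have hdet : W.det = (V.det : ℝ) := by
    have h1 : (V.det : ℝ) = (Matrix.of fun i j => (w i j : ℝ)).det := by
      rw [hV]
      exact Int.cast_det V
    rw [h1, ← Matrix.det_transpose, ← Matrix.det_transpose (Matrix.of _)]
    refine Matrix.det_eq_of_forall_row_eq_smul_add_const
      (fun j => match j with | none => 0 | some j => -x₀ j) none rfl ?_
    intro j i
    simp only [Matrix.transpose_apply, W, Matrix.of_apply]
    cases j <;> (simp; try ring)
  have hbound : |W.det| < 1 := by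
    have h1 := abs_det_le_of_entry_bounds W (fun i => |(w i none : ℝ)|)
      (fun j => match j with | none => 1 | some _ => 2 / R) ?_
    · have h2 : ∏ i, |(w i none : ℝ)| ≤ θ * R ^ m := by
        refine le_of_pow_le_pow_left₀ (Nat.succ_ne_zero m) (by positivity) ?_
        rw [← Finset.prod_pow]
        calc _ ≤ ∏ _i : Option (Fin m), (θ * R ^ m) :=
              Finset.prod_le_prod (fun _ _ => by positivity) fun i _ => (hS _ (hwS i)).1
          _ = _ := by simp
      refine h1.trans_lt ?_
      simp only [Fintype.prod_option, Finset.prod_const, Finset.card_univ, Fintype.card_fin,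
        one_mul, Fintype.card_option]
      rw [Fintype.prod_option] at h2
      calc _ ≤ ((m + 1).factorial : ℝ) * ((θ * R ^ m) * (2 / R) ^ m) := by gcongr
        _ = (m + 1).factorial * (2 ^ m * θ) := by
          rw [div_pow]; field_simp
        _ < 1 := hsmall
    · intro i j
      cases j with
      | none => simp [W]
      | some j =>
        have := (hS _ (hwS i)).2 j
        simp only [W, Matrix.of_apply]
        rwa [mul_comm (x₀ j)]
  rw [hdet] at hbound
  have h0 : V.det = 0 := by
    rw [← Int.cast_abs] at hbound
    exact Int.abs_lt_one_iff.1 (by exact_mod_cast hbound)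
  rw [hV]
  have := Int.cast_det (R := ℝ) V
  rw [h0, Int.cast_zero] at this
  exact this.symm

/-- The cubes of level `k` on which no rational vector of denominator at most
`(θ b ^ ((k - 1) m)) ^ (1 / (m + 1))` is too close. -/
def IsGoodCube {m : ℕ} (θ : ℝ) (b k : ℕ) (z : Fin m → ℤ) : Prop :=
  ∀ x ∈ adicCube b k z, ∀ q : ℤ, q ≠ 0 →
    |(q : ℝ)| ^ (m + 1) * (b : ℝ) ^ m ≤ θ * ((b : ℝ) ^ k) ^ m →
    ∀ p : Fin m → ℤ, 1 / (b : ℝ) ^ (2 * m) ≤ |(q : ℝ)| * ‖fun i => (q : ℝ) * x i - (p i : ℝ)‖ ^ m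

theorem one_le_abs_intCast {q : ℤ} (hq : q ≠ 0) : 1 ≤ |(q : ℝ)| := by
  exact_mod_cast Int.one_le_abs hq

/-- The violating vector is new at level `k + 1`, as the parent is good. Its denominator is thus too
large for level `k`, so failing the constant `b ^ (-2m)` places the rational point within `θ⁻¹ b ^
(-(k + 1))` of `x`, the scale of the child. This balance dictates the exponent `2m`. -/
theorem exists_rational_near_bad_child {m b k : ℕ} (hm : 0 < m) (hb : 0 < b) {θ : ℝ}
    (hθ0 : 0 < θ) (hθ1 : θ ≤ 1) {z : Fin m → ℤ} (hz : IsGoodCube θ b k z)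
    (a : Fin m → Fin b) (ha : ¬ IsGoodCube θ b (k + 1) (adicChild z a)) :
    ∃ x ∈ adicCube b (k + 1) (adicChild z a), ∃ v : Option (Fin m) → ℤ, v none ≠ 0 ∧
      |(v none : ℝ)| ^ (m + 1) ≤ θ * ((b : ℝ) ^ k) ^ m ∧
      ∀ i, |(v (some i) : ℝ) - v none * x i| ≤ |(v none : ℝ)| * (1 / θ / (b : ℝ) ^ (k + 1)) := by
  have hb0 : (0 : ℝ) < b := by exact_mod_cast hb
  simp only [IsGoodCube] at ha
  set c : ℝ := 1 / (b : ℝ) ^ (2 * m) with hc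
  have hbk : (0 : ℝ) < (b : ℝ) ^ k := by positivity
  push Not at ha
  obtain ⟨x, hx, q, hq, hqle, p, hlt⟩ := ha
  refine ⟨x, hx, fun i => i.elim q p, hq, ?_, fun i => ?_⟩
  · simp only [Option.elim]
    rw [pow_succ (b : ℝ) k, mul_pow, ← mul_assoc] at hqle
    exact le_of_mul_le_mul_right hqle (by positivity)
  · simp only [Option.elim]
    by_contra! hbig
    have hq0 : 0 < |(q : ℝ)| := by linarith [one_le_abs_intCast hq]
    have h1 : |(q : ℝ)| * (1 / θ / (b : ℝ) ^ (k + 1)) ≤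
        ‖fun i => (q : ℝ) * x i - (p i : ℝ)‖ := by
      refine hbig.le.trans ?_
      rw [abs_sub_comm]
      exact norm_le_pi_norm (fun i => (q : ℝ) * x i - (p i : ℝ)) i
    have h2 : |(q : ℝ)| * (|(q : ℝ)| * (1 / θ / (b : ℝ) ^ (k + 1))) ^ m < c :=
      lt_of_le_of_lt (by gcongr) hlt
    have h3 : ¬ |(q : ℝ)| ^ (m + 1) * (b : ℝ) ^ m ≤ θ * ((b : ℝ) ^ k) ^ m := fun h =>
      absurd (hz x (adicCube_child_subset z a hx) q hq h p) (not_le.2 hlt)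
    apply h3
    have h4 : |(q : ℝ)| * (|(q : ℝ)| * (1 / θ / (b : ℝ) ^ (k + 1))) ^ m =
        |(q : ℝ)| ^ (m + 1) / (θ ^ m * ((b : ℝ) ^ (k + 1)) ^ m) := by
      rw [mul_pow, div_pow, div_pow]; field_simp; ring
    rw [h4, div_lt_iff₀ (by positivity)] at h2
    have h5 : c * (θ ^ m * ((b : ℝ) ^ (k + 1)) ^ m) * (b : ℝ) ^ m =
        θ ^ m * ((b : ℝ) ^ k) ^ m := by
      rw [hc, pow_mul', pow_succ (b : ℝ) k, mul_pow]; field_simp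
    calc |(q : ℝ)| ^ (m + 1) * (b : ℝ) ^ m ≤
          c * (θ ^ m * ((b : ℝ) ^ (k + 1)) ^ m) * (b : ℝ) ^ m := by gcongr
      _ = θ ^ m * ((b : ℝ) ^ k) ^ m := h5
      _ ≤ θ * ((b : ℝ) ^ k) ^ m := by
        gcongr
        exact pow_le_of_le_one hθ0.le hθ1 hm.ne'

-- The offending rationals are all within `2 / b ^ k` of the corner of the parent, so they lie on
-- one hyperplane, and every bad child lies within boundedly many child widths of it.
open Classical in
theorem card_bad_children_le {m b k : ℕ} (hm : 0 < m) (hb : 0 < b) {θ : ℝ} (hθ0 : 0 < θ)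
    (hθ1 : θ ≤ 1) (hsmall : (m + 1).factorial * (2 ^ m * θ) < 1) (hbθ : 1 / θ ≤ b)
    {z : Fin m → ℤ} (hz : IsGoodCube θ b k z) :
    ((Finset.univ.filter fun a : Fin m → Fin b =>
      ¬ IsGoodCube θ b (k + 1) (adicChild z a)).card : ℝ) ≤
      (2 * (m / θ + m) + 1) * (b : ℝ) ^ (m - 1) := by
  have hb0 : (0 : ℝ) < b := by exact_mod_cast hb
  have hbk : (0 : ℝ) < (b : ℝ) ^ k := by positivity
  have hviol := exists_rational_near_bad_child hm hb hθ0 hθ1 hz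
  choose! X hX V hV0 hVle hVX using hviol
  let x₀ : Fin m → ℝ := fun i => (z i : ℝ) / (b : ℝ) ^ k
  obtain ⟨α, hα0, hα⟩ := exists_hyperplane_of_small_denominators (m := m) (R := (b : ℝ) ^ k)
    hθ0.le hbk
    hsmall x₀
    (V '' {a | ¬ IsGoodCube θ b (k + 1) (adicChild z a)}) (by
      rintro _ ⟨a, ha, rfl⟩
      refine ⟨hVle a ha, fun i => ?_⟩
      have h1 := hVX a ha i
      have h2 : |X a i - x₀ i| ≤ 1 / (b : ℝ) ^ k := by
        obtain ⟨h3, h4⟩ := adicCube_child_subset z a (hX a ha) i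
        have h5 : X a i - x₀ i = ((b : ℝ) ^ k * X a i - z i) / (b : ℝ) ^ k := by
          simp only [x₀]; field_simp
        rw [h5, abs_div, abs_of_pos hbk]
        gcongr
        rw [abs_le]; constructor <;> linarith
      have h3 : 1 / θ / (b : ℝ) ^ (k + 1) ≤ 1 / (b : ℝ) ^ k := by
        rw [pow_succ, div_le_div_iff₀ (by positivity) hbk, one_mul, mul_comm]
        gcongr
      calc _ = |((V a (some i) : ℝ) - V a none * X a i) + V a none * (X a i - x₀ i)| := by
            congr 1; ring
        _ ≤ |(V a (some i) : ℝ) - V a none * X a i| + |V a none * (X a i - x₀ i)| :=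
          abs_add_le _ _
        _ ≤ |(V a none : ℝ)| * (1 / (b : ℝ) ^ k) + |(V a none : ℝ)| * (1 / (b : ℝ) ^ k) := by
          rw [abs_mul]
          exact add_le_add (h1.trans (by gcongr)) (by gcongr)
        _ = _ := by ring)
  by_cases hne : ∃ a : Fin m → Fin b, ¬ IsGoodCube θ b (k + 1) (adicChild z a)
  swap
  · push Not at hne
    rw [Finset.filter_false_of_mem (fun a _ => not_not.2 (hne a))]
    simp only [Finset.card_empty, Nat.cast_zero]
    positivity
  -- The affine hyperplane is genuine: with no linear part, the relation at a vector of nonzero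
  -- denominator would force the constant term to vanish too.
  have hα' : (fun i => α (some i)) ≠ 0 := by
    intro h0
    obtain ⟨a, ha⟩ := hne
    have h1 := hα _ ⟨a, ha, rfl⟩
    rw [Fintype.sum_option, Finset.sum_eq_zero (fun i _ => by
      rw [show α (some i) = 0 from congrFun h0 i, zero_mul]), add_zero] at h1
    have h2 : α none = 0 := (mul_eq_zero.1 h1).resolve_right (by exact_mod_cast hV0 a ha)
    apply hα0
    funext i
    cases i with
    | none => exact h2
    | some i => exact congrFun h0 i
  obtain ⟨j₀, hj0, hjmax⟩ := exists_max_abs _ hα'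
  set γ : ℝ := ∑ j, α (some j) * (b * z j) + (b : ℝ) ^ (k + 1) * α none
  have hsub : (Finset.univ.filter fun a : Fin m → Fin b => ¬ IsGoodCube θ b (k + 1) (adicChild z a)) ⊆
      Finset.univ.filter fun a : Fin m → Fin b =>
        |∑ j, α (some j) * ((a j : ℕ) : ℝ) + γ| ≤ |α (some j₀)| * (m / θ + m) := by
    intro a ha
    rw [Finset.mem_filter] at ha ⊢
    refine ⟨Finset.mem_univ _, ?_⟩
    have ha := ha.2
    have hnear : |∑ j, α (some j) * X a j + α none| ≤
        |α (some j₀)| * (m / θ / (b : ℝ) ^ (k + 1)) := by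
      have hv0 : (0 : ℝ) < |(V a none : ℝ)| := by linarith [one_le_abs_intCast (hV0 a ha)]
      refine le_of_mul_le_mul_left ?_ hv0
      have h1 := hα _ ⟨a, ha, rfl⟩
      rw [Fintype.sum_option] at h1
      rw [← abs_mul]
      have h2 : (V a none : ℝ) * (∑ j, α (some j) * X a j + α none) =
          - ∑ j, α (some j) * ((V a (some j) : ℝ) - V a none * X a j) := by
        simp only [mul_sub, Finset.sum_sub_distrib, mul_add, Finset.mul_sum]
        have h3 : ∀ j, (V a none : ℝ) * (α (some j) * X a j) =
          α (some j) * (V a none * X a j) := fun j => by ring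
        simp only [h3]
        linarith
      rw [h2, abs_neg]
      calc _ ≤ ∑ j, |α (some j) * ((V a (some j) : ℝ) - V a none * X a j)| :=
            Finset.abs_sum_le_sum_abs _ _
        _ ≤ ∑ _j : Fin m, |α (some j₀)| *
              (|(V a none : ℝ)| * (1 / θ / (b : ℝ) ^ (k + 1))) := by
          refine Finset.sum_le_sum fun j _ => ?_
          rw [abs_mul]
          exact mul_le_mul (hjmax j) (hVX a ha j) (abs_nonneg _) (abs_nonneg _)
        _ = _ := by simp; ring
    have := abs_digits_le_of_near_hyperplane z a id (fun j => α (some j)) j₀ hjmax (α none)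
      (hX a ha) hnear
    rw [Fintype.card_fin, mul_div_cancel₀ _ (by positivity)] at this
    exact this
  calc _ ≤ ((Finset.univ.filter fun a : Fin m → Fin b =>
        |∑ j, α (some j) * ((a j : ℕ) : ℝ) + γ| ≤ |α (some j₀)| * (m / θ + m)).card : ℝ) := by
        exact_mod_cast Finset.card_le_card hsub
    _ ≤ (b : ℝ) ^ (Fintype.card (Fin m) - 1) * (2 * (m / θ + m) + 1) :=
      card_digits_near_hyperplane (fun j => α (some j)) j₀ hj0 γ (by positivity)
    _ = _ := by rw [Fintype.card_fin, mul_comm]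

/-- The proportion of lost children is `C / b`. The threshold on `b` secures `1 / θ ≤ b`, `C / b ≤ 1
/ 2` and `4 ≤ b`. -/
theorem le_dimH_badVectors {m : ℕ} (hm : 0 < m) : ∃ (C : ℝ) (b₀ : ℕ), ∀ b : ℕ, b₀ ≤ b →
    ENNReal.ofReal (m - C / (b * Real.log b)) ≤ dimH (badVectors m (1 / (b : ℝ) ^ (2 * m))) := by
  classical
  set θ : ℝ := 1 / ((m + 1).factorial * 2 ^ m * 2) with hθ
  have hf : (1 : ℝ) ≤ (m + 1).factorial := by exact_mod_cast Nat.succ_le_of_lt (Nat.factorial_pos _)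
  have h2m : (1 : ℝ) ≤ 2 ^ m := one_le_pow₀ (by norm_num)
  have hθ0 : 0 < θ := by positivity
  have hθ1 : θ ≤ 1 := by
    rw [hθ, div_le_one (by positivity)]; nlinarith
  set C : ℝ := 2 * (m / θ + m) + 1 with hC
  have hC0 : 0 < C := by positivity
  refine ⟨2 * C, ⌈1 / θ⌉₊ + ⌈2 * C⌉₊ + 4, fun b hb => ?_⟩
  have hb4 : 4 ≤ b := by omega
  have hbθ : 1 / θ ≤ b := (Nat.le_ceil _).trans (by exact_mod_cast (by omega : ⌈1 / θ⌉₊ ≤ b))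
  have hbC : 2 * C ≤ b := (Nat.le_ceil _).trans (by exact_mod_cast (by omega : ⌈2 * C⌉₊ ≤ b))
  have hb0 : (0 : ℝ) < b := by exact_mod_cast (by omega : 0 < b)
  set c : ℝ := 1 / (b : ℝ) ^ (2 * m) with hc
  have : Nonempty (Fin m) := ⟨⟨0, hm⟩⟩
  -- At the root no nonzero denominator is admitted, since `b ^ m > θ`, so the condition is vacuous.
  have hG0 : IsGoodCube θ b 0 (0 : Fin m → ℤ) := by
    intro x _ q hq hle
    exfalso
    have h1 : (1 : ℝ) ≤ |(q : ℝ)| ^ (m + 1) := one_le_pow₀ (one_le_abs_intCast hq)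
    have h2 : (4 : ℝ) ≤ (b : ℝ) ^ m :=
      (by exact_mod_cast hb4 : (4 : ℝ) ≤ b).trans
        (le_self_pow₀ (by exact_mod_cast (by omega : 1 ≤ b)) hm.ne')
    simp at hle
    nlinarith
  have key := le_dimH_of_sparse_tree (δ := C / b) hb4 (by positivity)
    (by rw [div_le_div_iff₀ hb0 (by norm_num)]; linarith) (IsGoodCube θ b) 0 hG0 ?_
  · rw [Fintype.card_fin] at key
    refine le_trans (le_of_eq ?_) (key.trans (dimH_mono ?_))
    · congr 2; rw [mul_div_assoc', div_div]
    · intro x hx q hq p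
      have hb1 : (1 : ℝ) < (b : ℝ) := by exact_mod_cast (by omega : 1 < b)
      obtain ⟨k, hk⟩ := pow_unbounded_of_one_lt (|(q : ℝ)| ^ (m + 1) * (b : ℝ) ^ m / θ) hb1
      obtain ⟨z, hz, hxz⟩ := hx k
      refine hz x hxz q hq ?_ p
      rw [div_lt_iff₀ hθ0, mul_comm ((b : ℝ) ^ k)] at hk
      refine hk.le.trans ?_
      gcongr
      exact le_self_pow₀ (one_le_pow₀ hb1.le) hm.ne'
  intro k z hz
  rw [Fintype.card_fin]
  refine (card_bad_children_le hm (by omega) hθ0 hθ1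
    (by rw [hθ]; field_simp; norm_num) hbθ hz).trans (le_of_eq ?_)
  obtain ⟨l, rfl⟩ := Nat.exists_eq_succ_of_ne_zero hm.ne'
  rw [← hC, Nat.succ_sub_one, Nat.succ_eq_add_one, pow_succ]
  field_simp

/-! ### The row case, through transference. -/

/-- The vectors `x` with `‖q‖ ^ n |q · x - p| ≥ c` for all nonzero `q ∈ ℤⁿ` and all `p`. -/
def badForms (n : ℕ) (c : ℝ) : Set (Fin n → ℝ) :=
  {x | ∀ q : Fin n → ℤ, q ≠ 0 → ∀ p : ℤ,
    c ≤ ‖fun i => (q i : ℝ)‖ ^ n * |∑ i, (q i : ℝ) * x i - p|}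

/-- Minkowski's theorem for the forms used in the transference principle. -/
theorem exists_transference_point {n : ℕ} (x : Fin n → ℝ) (q : Fin n → ℤ) (p : ℤ) (i₀ : Fin n)
    (hq : q i₀ ≠ 0) {T δ : ℝ} (hT : 0 < T) (hδ : 0 < δ)
    (h : |(q i₀ : ℝ)| < T * δ ^ (n - 1)) :
    ∃ (Q : ℤ) (P : Fin n → ℤ), (Q ≠ 0 ∨ P ≠ 0) ∧ |(Q : ℝ)| < T ∧
      (∀ i, i ≠ i₀ → |(Q : ℝ) * x i - P i| < δ) ∧ ∑ i, q i * P i = p * Q := by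
  -- Row `i₀` of the system is the integer form `q · P - p Q`. Bounding it strictly by 1 makes it
  -- vanish, and this exact relation is what controls coordinate `i₀` later.
  let D : Matrix (Fin n) (Fin n) ℝ :=
    (1 : Matrix (Fin n) (Fin n) ℝ).updateRow i₀ fun j => (q j : ℝ)
  let E : Matrix (Fin n) Unit ℝ := fun i _ => if i = i₀ then -(p : ℝ) else -x i
  let M : Matrix (Unit ⊕ Fin n) (Unit ⊕ Fin n) ℝ := Matrix.fromBlocks 1 0 E D
  have hD : D.det = q i₀ := by
    have := Matrix.cramer_transpose_apply (1 : Matrix (Fin n) (Fin n) ℝ) (fun j => (q j : ℝ)) i₀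
    rw [Matrix.transpose_one, Matrix.cramer_one] at this
    exact this.symm
  have hM : M.det = q i₀ := by
    rw [Matrix.det_fromBlocks_zero₁₂, hD, Matrix.det_one, one_mul]
  obtain ⟨v, hv0, hv⟩ := minkowski_linear_forms M (by rw [hM]; exact_mod_cast hq)
    (Sum.elim (fun _ => T) fun i => if i = i₀ then 1 else δ)
    (by rintro (_ | i) <;> simp only [Sum.elim_inl, Sum.elim_inr] <;> [skip; split_ifs] <;>
      positivity)
    (by
      rw [hM]
      simp only [Fintype.prod_sum_type, Sum.elim_inl, Sum.elim_inr, Finset.univ_unique,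
        Finset.prod_singleton]
      rw [← Finset.mul_prod_erase _ _ (Finset.mem_univ i₀), if_pos rfl,
        Finset.prod_congr rfl (g := fun _ => δ)
          (fun i hi => if_neg (Finset.ne_of_mem_erase hi)), Finset.prod_const,
        Finset.card_erase_of_mem (Finset.mem_univ _), Finset.card_univ, Fintype.card_fin, one_mul]
      exact h)
  have hinr : ∀ i, (M *ᵥ fun j => (v j : ℝ)) (Sum.inr i) =
      E i () * v (Sum.inl ()) + (D *ᵥ fun j => (v (Sum.inr j) : ℝ)) i := by
    intro i
    simp only [M, Matrix.fromBlocks_mulVec, Sum.elim_inr, Pi.add_apply]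
    congr 1
    simp [Matrix.mulVec, dotProduct]
  have hDmul : ∀ i, (D *ᵥ fun j => (v (Sum.inr j) : ℝ)) i =
      if i = i₀ then ∑ j, (q j : ℝ) * v (Sum.inr j) else v (Sum.inr i) := by
    intro i
    by_cases hi : i = i₀
    · subst hi
      simp [D, Matrix.mulVec, dotProduct]
    · have := congrFun (Matrix.one_mulVec fun j => (v (Sum.inr j) : ℝ)) i
      simp only [hi, if_false]
      rw [← this]
      simp only [D, Matrix.mulVec, dotProduct, Matrix.updateRow_ne hi]
  refine ⟨v (Sum.inl ()), fun i => v (Sum.inr i), ?_, ?_, fun i hi => ?_, ?_⟩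
  · by_contra! hcon
    apply hv0
    funext j
    rcases j with j | j
    · exact hcon.1
    · exact congrFun hcon.2 j
  · have := hv (Sum.inl ())
    simpa [M, Matrix.fromBlocks_mulVec] using this
  · have := hv (Sum.inr i)
    rw [hinr, hDmul] at this
    simp only [E, hi, if_false, Sum.elim_inr] at this
    rw [abs_sub_comm]
    convert this using 2
    ring
  · have := hv (Sum.inr i₀)
    rw [hinr, hDmul] at this
    simp only [E, if_true, Sum.elim_inr] at this
    have h1 : |∑ i, q i * v (Sum.inr i) - p * v (Sum.inl ())| < 1 := by
      have e : -(p : ℝ) * v (Sum.inl ()) + ∑ j, (q j : ℝ) * v (Sum.inr j) =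
          ((∑ i, q i * v (Sum.inr i) - p * v (Sum.inl ()) : ℤ) : ℝ) := by
        push_cast; ring
      rw [e] at this
      exact_mod_cast this
    exact sub_eq_zero.1 (Int.abs_lt_one_iff.1 h1)

theorem exists_abs_eq_norm {n : ℕ} (hn : 0 < n) (y : Fin n → ℝ) : ∃ i, ‖y‖ = |y i| := by
  have : Nonempty (Fin n) := ⟨⟨0, hn⟩⟩
  obtain ⟨i, hi⟩ := Finite.exists_max fun j => |y j|
  exact ⟨i, le_antisymm ((pi_norm_le_iff_of_nonneg (abs_nonneg _)).2 hi) (norm_le_pi_norm y i)⟩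

/-- Khintchine's transference principle. -/
theorem badVectors_subset_badForms {n : ℕ} (hn : 0 < n) {c : ℝ} (hc : 0 < c) (hc1 : c ≤ 1) :
    badVectors n c ⊆ badForms n (c ^ n / (2 * (4 * (n : ℝ) ^ n) ^ n)) := by
  intro x hx q hq p
  obtain ⟨i₀, hi₀⟩ := exists_abs_eq_norm hn fun i => (q i : ℝ)
  rw [hi₀]
  have hmax : ∀ i, |(q i : ℝ)| ≤ |(q i₀ : ℝ)| := fun i => by
    rw [← hi₀]; exact norm_le_pi_norm (fun i => (q i : ℝ)) i
  have hqi : q i₀ ≠ 0 := by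
    intro h0
    apply hq
    funext i
    have := hmax i
    rw [h0, Int.cast_zero, abs_zero] at this
    exact_mod_cast abs_nonpos_iff.1 this
  set s := |(q i₀ : ℝ)| with hs
  have hs1 : 1 ≤ s := one_le_abs_intCast hqi
  have hs0 : 0 < s := by linarith
  by_contra! hlt
  set e := |∑ i, (q i : ℝ) * x i - p| with he
  have hn1 : (1 : ℝ) ≤ n := by exact_mod_cast hn
  have hn0 : (0 : ℝ) < n := by linarith
  have hnn : (n : ℝ) ≤ (n : ℝ) ^ n := le_self_pow₀ hn1 hn.ne'
  -- The choices make `T * δ ^ (n - 1) = 2 * s`, above the determinant `s`, and `T * (n * δ) ^ n = c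
  -- / 2`, which contradicts bad approximability of `x`. Also `n * δ < 1`, which excludes `Q = 0`.
  set δ : ℝ := c / (4 * (n : ℝ) ^ n * s) with hδ
  have hδ0 : 0 < δ := by positivity
  have hnδ : n * δ ≤ 1 / 4 := by
    rw [hδ, mul_div_assoc', div_le_div_iff₀ (by positivity) (by norm_num)]
    nlinarith [mul_le_mul hnn hs1 zero_le_one (by positivity)]
  set T : ℝ := 2 * s / δ ^ (n - 1) with hT
  have hT0 : 0 < T := by positivity
  obtain ⟨Q, P, hne, hQT, hP, hsum⟩ := exists_transference_point x q p i₀ hqi hT0 hδ0 (by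
    rw [hT, div_mul_cancel₀ _ (by positivity)]; linarith)
  have hδn : δ ^ (n - 1) * δ = δ ^ n := by
    rw [← pow_succ, Nat.sub_add_cancel hn]
  have heδ : 2 * e ≤ δ ^ n := by
    have h1 : δ ^ n * s ^ n = c ^ n / (4 * (n : ℝ) ^ n) ^ n := by
      rw [← mul_pow, hδ, ← div_pow]; congr 1; field_simp
    have h2 : s ^ n * (2 * e) < s ^ n * δ ^ n := by
      rw [mul_comm (s ^ n) (δ ^ n), h1]
      calc s ^ n * (2 * e) = 2 * (s ^ n * e) := by ring
        _ < 2 * (c ^ n / (2 * (4 * (n : ℝ) ^ n) ^ n)) := by gcongr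
        _ = _ := by field_simp
    exact (lt_of_mul_lt_mul_left h2 (by positivity)).le
  have hTe : T * e ≤ s * δ := by
    rw [hT, div_mul_eq_mul_div, div_le_iff₀ (by positivity), mul_assoc s, mul_comm δ, hδn]
    nlinarith
  have hu : ∀ i, |(Q : ℝ) * x i - P i| ≤ n * δ := by
    intro i
    by_cases hi : i = i₀
    · subst hi
      refine le_of_mul_le_mul_left ?_ hs0
      -- The relation `q · P = p Q` expresses the missing coordinate through `Q (q · x - p)` and the
      -- other coordinates. These contribute at most `s * δ` and `(n - 1) * (s * δ)`.
      have h1 : (q i : ℝ) * (Q * x i - P i) = Q * (∑ i, (q i : ℝ) * x i - p) -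
          ∑ j ∈ Finset.univ.erase i, (q j : ℝ) * (Q * x j - P j) := by
        have h2 : ∑ j, (q j : ℝ) * (Q * x j - P j) = Q * (∑ i, (q i : ℝ) * x i - p) := by
          have h3 : ∑ i, (q i : ℝ) * P i = p * Q := by exact_mod_cast hsum
          have h4 : ∑ j, (q j : ℝ) * (Q * x j) = Q * ∑ i, (q i : ℝ) * x i := by
            rw [Finset.mul_sum]; exact Finset.sum_congr rfl fun j _ => by ring
          simp only [mul_sub, Finset.sum_sub_distrib]
          rw [h3, h4]; ring
        rw [← h2, ← Finset.add_sum_erase _ _ (Finset.mem_univ i)]; ring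
      rw [hs, ← abs_mul, h1]
      refine (abs_sub _ _).trans ?_
      have h5 : |∑ j ∈ Finset.univ.erase i, (q j : ℝ) * (Q * x j - P j)| ≤
          (n - 1) * (s * δ) := by
        refine (Finset.abs_sum_le_sum_abs _ _).trans ?_
        calc _ ≤ ∑ _j ∈ Finset.univ.erase i, s * δ := by
              refine Finset.sum_le_sum fun j hj => ?_
              rw [abs_mul]
              exact mul_le_mul (hmax j) (hP j (Finset.ne_of_mem_erase hj)).le (abs_nonneg _) hs0.le
          _ = _ := by
            rw [Finset.sum_const, Finset.card_erase_of_mem (Finset.mem_univ _), Finset.card_univ,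
              Fintype.card_fin, nsmul_eq_mul, Nat.cast_sub hn, Nat.cast_one]
      rw [abs_mul, ← he]
      have h6 : |(Q : ℝ)| * e ≤ T * e := by gcongr
      rw [← hs]
      linarith
    · refine (hP i hi).le.trans ?_
      nlinarith
  have hQ0 : Q ≠ 0 := by
    rintro rfl
    rcases hne with h | h
    · exact h rfl
    · apply h
      funext i
      have h1 := hu i
      rw [Int.cast_zero, zero_mul, zero_sub, abs_neg] at h1
      have h2 : |(P i : ℝ)| < 1 := by linarith
      rw [← Int.cast_abs] at h2
      exact Int.abs_lt_one_iff.1 (by exact_mod_cast h2)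
  have h1 := hx Q hQ0 P
  have h2 : ‖fun i => (Q : ℝ) * x i - (P i : ℝ)‖ ≤ n * δ :=
    (pi_norm_le_iff_of_nonneg (by positivity)).2 hu
  have h3 : c ≤ T * (n * δ) ^ n := by
    refine h1.trans ?_
    gcongr
  have h4 : T * (n * δ) ^ n = c / 2 := by
    rw [mul_pow, ← hδn, hT]
    have : 2 * s / δ ^ (n - 1) * ((n : ℝ) ^ n * (δ ^ (n - 1) * δ)) = 2 * s * (n : ℝ) ^ n * δ := by
      field_simp
    rw [this, hδ]
    field_simp
    norm_num
  linarith

/-! ### The general case, through renormalized lattices. -/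

/-- The value `A q - p` of the affine forms with coefficient matrix `x`. -/
def affineForms {m n : ℕ} (x : Fin m × Fin n → ℝ) (q : Fin n → ℤ) (p : Fin m → ℤ) : Fin m → ℝ :=
  fun i => ∑ j, x (i, j) * (q j : ℝ) - p i

/-- The matrices `A` with `‖q‖ ^ n ‖A q - p‖ ^ m ≥ c` for all nonzero `q ∈ ℤⁿ` and all
`p ∈ ℤᵐ`, in the supremum norms. -/
def badMatrices (m n : ℕ) (c : ℝ) : Set (Fin m × Fin n → ℝ) :=
  {x | ∀ q : Fin n → ℤ, q ≠ 0 → ∀ p : Fin m → ℤ,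
    c ≤ ‖fun j => (q j : ℝ)‖ ^ n * ‖affineForms x q p‖ ^ m}

theorem one_le_norm_intCast {n : ℕ} {q : Fin n → ℤ} (hq : q ≠ 0) :
    1 ≤ ‖fun j => (q j : ℝ)‖ := by
  obtain ⟨j, hj⟩ := Function.ne_iff.1 hq
  exact (one_le_abs_intCast hj).trans (norm_le_pi_norm (fun j => (q j : ℝ)) j)

open Classical in
/-- The number of subcubes on which given affine forms take a small value. -/
theorem card_children_small_value {m n B k : ℕ} (hn : 0 < n) (z : Fin m × Fin n → ℤ)
    (q : Fin n → ℤ) (hq : q ≠ 0) (p : Fin m → ℤ) {η : ℝ} (hη : 0 ≤ η) :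
    ((Finset.univ.filter fun a : Fin m × Fin n → Fin B =>
      ∃ x ∈ adicCube B (k + 1) (adicChild z a), ‖affineForms x q p‖ ≤ η).card : ℝ) ≤
      ((B : ℝ) ^ (n - 1) *
        (2 * ((B : ℝ) ^ (k + 1) * (η / ‖fun j => (q j : ℝ)‖) + n) + 1)) ^ m := by
  obtain ⟨j₀, hj₀⟩ := exists_abs_eq_norm hn fun j => (q j : ℝ)
  have hs := one_le_norm_intCast hq
  rw [hj₀] at hs ⊢
  have hmax : ∀ j, |(q j : ℝ)| ≤ |(q j₀ : ℝ)| := fun j => by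
    rw [← hj₀]; exact norm_le_pi_norm (fun j => (q j : ℝ)) j
  have hs0 : 0 < |(q j₀ : ℝ)| := by linarith
  set R := (B : ℝ) ^ (k + 1) * (η / |(q j₀ : ℝ)|) + n with hR
  have hR0 : 0 ≤ R := by positivity
  let γ : Fin m → ℝ := fun i =>
    ∑ j, (q j : ℝ) * (B * z (i, j)) + (B : ℝ) ^ (k + 1) * -(p i : ℝ)
  let S : Fin m → Finset (Fin n → Fin B) := fun i => Finset.univ.filter fun a =>
    |∑ j, (q j : ℝ) * ((a j : ℕ) : ℝ) + γ i| ≤ |(q j₀ : ℝ)| * R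
  have hS : ∀ i, ((S i).card : ℝ) ≤ (B : ℝ) ^ (n - 1) * (2 * R + 1) := by
    intro i
    have := card_digits_near_hyperplane (b := B) (fun j => (q j : ℝ)) j₀
      (abs_pos.1 hs0) (γ i) hR0
    rwa [Fintype.card_fin] at this
  have hcard : (Finset.univ.filter fun a : Fin m × Fin n → Fin B =>
      ∃ x ∈ adicCube B (k + 1) (adicChild z a), ‖affineForms x q p‖ ≤ η).card ≤
      (Fintype.piFinset S).card := by
    refine Finset.card_le_card_of_injOn (fun a i j => a (i, j)) ?_ ?_
    · intro a ha
      rw [Finset.mem_coe, Finset.mem_filter] at ha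
      obtain ⟨-, x, hx, hxη⟩ := ha
      refine Finset.mem_coe.2 (Fintype.mem_piFinset.2 fun i => ?_)
      refine Finset.mem_filter.2 ⟨Finset.mem_univ _, ?_⟩
      have h1 : |∑ j, (q j : ℝ) * x (i, j) + -(p i : ℝ)| ≤ |(q j₀ : ℝ)| * (η / |(q j₀ : ℝ)|) := by
        rw [mul_div_cancel₀ _ hs0.ne']
        refine le_trans (le_of_eq ?_) ((norm_le_pi_norm (affineForms x q p) i).trans hxη)
        rw [Real.norm_eq_abs, affineForms, ← sub_eq_add_neg]
        simp only [mul_comm]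
      have := abs_digits_le_of_near_hyperplane z a (fun j => (i, j)) (fun j => (q j : ℝ)) j₀ hmax
        (-(p i : ℝ)) hx h1
      rwa [Fintype.card_fin] at this
    · intro a _ a' _ h
      funext ⟨i, j⟩
      exact congrFun (congrFun h i) j
  calc _ ≤ ((Fintype.piFinset S).card : ℝ) := by exact_mod_cast hcard
    _ = ∏ i, ((S i).card : ℝ) := by rw [Fintype.card_piFinset]; push_cast; rfl
    _ ≤ ∏ _i : Fin m, ((B : ℝ) ^ (n - 1) * (2 * R + 1)) :=
      Finset.prod_le_prod (fun _ _ => by positivity) fun i _ => hS i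
    _ = _ := by simp

/-- The renormalized lattice `(u⁻¹ q, w (A q - p))`. -/
noncomputable def flowMatrix {m n : ℕ} (u w : ℝ) (x : Fin m × Fin n → ℝ) :
    Matrix (Fin n ⊕ Fin m) (Fin n ⊕ Fin m) ℝ :=
  Matrix.fromBlocks (u⁻¹ • 1) 0 (w • Matrix.of fun i j => x (i, j)) (-w • 1)

theorem abs_det_flowMatrix {m n : ℕ} {u w : ℝ} (hu : 0 < u) (hw : 0 < w)
    (h : w ^ m = u ^ n) (x : Fin m × Fin n → ℝ) : |(flowMatrix u w x).det| = 1 := by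
  rw [flowMatrix, Matrix.det_fromBlocks_zero₁₂, Matrix.det_smul, Matrix.det_smul, Matrix.det_one,
    Matrix.det_one, mul_one, mul_one, Fintype.card_fin, Fintype.card_fin, abs_mul, abs_pow,
    abs_pow, abs_neg, abs_of_pos hw, abs_of_pos (inv_pos.2 hu), h, ← mul_pow,
    inv_mul_cancel₀ hu.ne', one_pow]

theorem norm_flowMatrix_mulVec_le {m n : ℕ} {u w : ℝ} (hu : 0 < u) (hw : 0 < w)
    (x : Fin m × Fin n → ℝ) (v : Fin n ⊕ Fin m → ℤ) {r : ℝ} (hr : 0 ≤ r) :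
    ‖flowMatrix u w x *ᵥ fun j => (v j : ℝ)‖ ≤ r ↔
      ‖fun j => (v (Sum.inl j) : ℝ)‖ ≤ r * u ∧
      w * ‖affineForms x (fun j => v (Sum.inl j)) (fun i => v (Sum.inr i))‖ ≤ r := by
  have h1 : ∀ j, (flowMatrix u w x *ᵥ fun j => (v j : ℝ)) (Sum.inl j) =
      u⁻¹ * v (Sum.inl j) := by
    intro j
    simp [flowMatrix, Matrix.fromBlocks_mulVec, Matrix.smul_mulVec, Function.comp_def]
  have h2 : ∀ i, (flowMatrix u w x *ᵥ fun j => (v j : ℝ)) (Sum.inr i) =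
      w * affineForms x (fun j => v (Sum.inl j)) (fun i => v (Sum.inr i)) i := by
    intro i
    simp only [flowMatrix, Matrix.fromBlocks_mulVec, Matrix.smul_mulVec, Function.comp_def,
      Matrix.one_mulVec, Sum.elim_inr, Pi.add_apply, Pi.smul_apply, smul_eq_mul, affineForms]
    rw [Matrix.mulVec, dotProduct]
    simp only [Matrix.of_apply]
    ring
  rw [pi_norm_le_iff_of_nonneg hr, Sum.forall, pi_norm_le_iff_of_nonneg (by positivity),
    ← le_div_iff₀' hw, pi_norm_le_iff_of_nonneg (by positivity)]
  refine and_congr (forall_congr' fun j => ?_) (forall_congr' fun i => ?_)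
  · rw [h1, norm_mul, Real.norm_of_nonneg (inv_pos.2 hu).le, inv_mul_le_iff₀ hu, mul_comm]
  · rw [h2, norm_mul, Real.norm_of_nonneg hw.le, ← le_div_iff₀' hw]

/-- The lattice point count in the renormalized lattice. -/
theorem card_integer_points_le {m n : ℕ} {u w b Y : ℝ} (hu : 0 < u) (hw : 0 < w)
    (hb : 0 < b) (hY : 0 ≤ Y) (h : w ^ m = u ^ n) (x : Fin m × Fin n → ℝ)
    (hmin : ∀ (q : Fin n → ℤ) (p : Fin m → ℤ), (q ≠ 0 ∨ p ≠ 0) →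
      u ≤ b * ‖fun j => (q j : ℝ)‖ ∨ 1 ≤ b * (w * ‖affineForms x q p‖))
    (X : Finset (Fin n ⊕ Fin m → ℤ))
    (hX : ∀ v ∈ X, ‖fun j => (v (Sum.inl j) : ℝ)‖ ≤ Y * u ∧
      w * ‖affineForms x (fun j => v (Sum.inl j)) (fun i => v (Sum.inr i))‖ ≤ Y) :
    (X.card : ℝ) ≤ (2 * (Y + (4 * b) ^ (n + m - 1))) ^ (n + m) := by
  have hdet := abs_det_flowMatrix hu hw h x
  have hmin' : ∀ v : Fin n ⊕ Fin m → ℤ, v ≠ 0 →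
      1 / b ≤ ‖flowMatrix u w x *ᵥ fun j => (v j : ℝ)‖ := by
    intro v hv
    obtain ⟨h1, h2⟩ := (norm_flowMatrix_mulVec_le hu hw x v (norm_nonneg _)).1 le_rfl
    rw [div_le_iff₀' hb]
    rcases hmin (fun j => v (Sum.inl j)) (fun i => v (Sum.inr i)) (by
      by_contra! hcon
      apply hv
      funext j
      rcases j with j | j
      · exact congrFun hcon.1 j
      · exact congrFun hcon.2 j) with h3 | h3
    · have h4 : u * 1 ≤ u * (b * ‖flowMatrix u w x *ᵥ fun j => (v j : ℝ)‖) := by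
        calc u * 1 ≤ b * ‖fun j => (v (Sum.inl j) : ℝ)‖ := by rw [mul_one]; exact h3
          _ ≤ b * (‖flowMatrix u w x *ᵥ fun j => (v j : ℝ)‖ * u) := by gcongr
          _ = _ := by ring
      exact le_of_mul_le_mul_left h4 hu
    · exact h3.trans (by gcongr)
  have := card_lattice_points_le (flowMatrix u w x) hdet
    (D := (4 / (1 / b)) ^ (Fintype.card (Fin n ⊕ Fin m) - 1)) (by positivity) hY
    (exists_lattice_point_near _ hdet (by positivity) hmin') X
    (fun v hv => (norm_flowMatrix_mulVec_le hu hw x v hY).2 (hX v hv))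
  rwa [Fintype.card_sum, Fintype.card_fin, Fintype.card_fin, div_div_eq_mul_div, div_one] at this

/-- The cubes of level `k` on which the renormalized lattices `(U ^ (-k) q, W ^ k (A q - p))` have
no nonzero vector shorter than `1 / b`. -/
def IsLatticeGoodCube {m n : ℕ} (b U W k : ℕ) (z : Fin m × Fin n → ℤ) : Prop :=
  ∀ x ∈ adicCube (U * W) k z, ∀ (q : Fin n → ℤ) (p : Fin m → ℤ), (q ≠ 0 ∨ p ≠ 0) →
    (U : ℝ) ^ k ≤ b * ‖fun j => (q j : ℝ)‖ ∨ 1 ≤ (b : ℝ) * ((W : ℝ) ^ k * ‖affineForms x q p‖)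

theorem affineForms_zero_left {m n : ℕ} (x : Fin m × Fin n → ℝ) (p : Fin m → ℤ) :
    ‖affineForms x 0 p‖ = ‖fun i => (p i : ℝ)‖ := by
  rw [← norm_neg]
  congr 1
  funext i
  simp [affineForms]

theorem norm_affineForms_le {m n : ℕ} (x y : Fin m × Fin n → ℝ) (q : Fin n → ℤ)
    (p : Fin m → ℤ) {r : ℝ} (hr : 0 ≤ r) (h : ∀ i, |x i - y i| ≤ r) :
    ‖affineForms x q p‖ ≤ n * (r * ‖fun j => (q j : ℝ)‖) + ‖affineForms y q p‖ := by
  refine (pi_norm_le_iff_of_nonneg (by positivity)).2 fun i => ?_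
  have h1 : affineForms x q p i =
      ∑ j, (x (i, j) - y (i, j)) * (q j : ℝ) + affineForms y q p i := by
    simp only [affineForms, sub_mul, Finset.sum_sub_distrib]; ring
  rw [h1]
  refine (norm_add_le _ _).trans (add_le_add ?_ (norm_le_pi_norm _ i))
  refine (norm_sum_le _ _).trans ?_
  calc _ ≤ ∑ _j : Fin n, r * ‖fun j => (q j : ℝ)‖ := by
        refine Finset.sum_le_sum fun j _ => ?_
        rw [norm_mul]
        exact mul_le_mul (h (i, j)) (norm_le_pi_norm (fun j => (q j : ℝ)) j) (norm_nonneg _) hr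
    _ = _ := by simp

/-- A bad subcube of a good cube is caused by a vector of the renormalized lattice whose length is
controlled by its `q`-component. -/
theorem exists_vector_of_bad_child {m n b U W k : ℕ} (hb : 2 ≤ b) (hU : 0 < U) (hW : 0 < W)
    {z : Fin m × Fin n → ℤ} (hz : IsLatticeGoodCube b U W k z)
    (a : Fin m × Fin n → Fin (U * W))
    (ha : ¬ IsLatticeGoodCube b U W (k + 1) (adicChild z a)) :
    ∃ v : Fin n ⊕ Fin m → ℤ, (fun j => v (Sum.inl j)) ≠ 0 ∧
      (U : ℝ) ^ k ≤ b * ‖fun j => (v (Sum.inl j) : ℝ)‖ ∧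
      b * ‖fun j => (v (Sum.inl j) : ℝ)‖ < (U : ℝ) ^ (k + 1) ∧
      (∃ x ∈ adicCube (U * W) (k + 1) (adicChild z a),
        ‖affineForms x (fun j => v (Sum.inl j)) (fun i => v (Sum.inr i))‖ ≤
          1 / (b * (W : ℝ) ^ (k + 1))) ∧
      (W : ℝ) ^ k * ‖affineForms (fun i => (z i : ℝ) / ((U * W : ℕ) : ℝ) ^ k)
        (fun j => v (Sum.inl j)) (fun i => v (Sum.inr i))‖ ≤
          (n + 1) * (‖fun j => (v (Sum.inl j) : ℝ)‖ / (U : ℝ) ^ k) := by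
  simp only [IsLatticeGoodCube] at ha
  push Not at ha
  obtain ⟨x, hx, q, p, hqp, hq, hxp⟩ := ha
  have hU1 : (1 : ℝ) ≤ U := by exact_mod_cast hU
  have hW1 : (1 : ℝ) ≤ W := by exact_mod_cast hW
  have hb2 : (2 : ℝ) ≤ b := by exact_mod_cast hb
  have hWk : (1 : ℝ) ≤ (W : ℝ) ^ k := one_le_pow₀ hW1
  have hWk1 : (1 : ℝ) ≤ (W : ℝ) ^ (k + 1) := one_le_pow₀ hW1
  have hWle : (W : ℝ) ^ k ≤ (W : ℝ) ^ (k + 1) := pow_le_pow_right₀ hW1 (Nat.le_succ k)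
  have hUk : (1 : ℝ) ≤ (U : ℝ) ^ k := one_le_pow₀ hU1
  have hq0 : q ≠ 0 := by
    rintro rfl
    have hp : p ≠ 0 := hqp.resolve_left (not_not.2 rfl)
    rw [affineForms_zero_left] at hxp
    have := one_le_norm_intCast hp
    nlinarith [mul_le_mul hWk1 this zero_le_one (by positivity)]
  -- Smallness of `W ^ (k + 1) * ‖A q - p‖` persists at level `k`, so goodness of the parent can
  -- only come from the `q`-component.
  have hqk : (U : ℝ) ^ k ≤ b * ‖fun j => (q j : ℝ)‖ := by
    refine (hz x (adicCube_child_subset z a hx) q p hqp).resolve_right fun h => ?_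
    have : (b : ℝ) * ((W : ℝ) ^ k * ‖affineForms x q p‖) ≤
        b * ((W : ℝ) ^ (k + 1) * ‖affineForms x q p‖) := by gcongr
    linarith
  refine ⟨Sum.elim q p, hq0, hqk, hq, ⟨x, hx, ?_⟩, ?_⟩
  · rw [le_div_iff₀ (by positivity)]
    simp only [Sum.elim_inl, Sum.elim_inr]
    change ‖affineForms x q p‖ * _ ≤ 1
    linarith
  · simp only [Sum.elim_inl, Sum.elim_inr]
    change (W : ℝ) ^ k * ‖affineForms _ q p‖ ≤ _
    have hBk : (0 : ℝ) < ((U * W : ℕ) : ℝ) ^ k := by positivity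
    have h1 := norm_affineForms_le (fun i => (z i : ℝ) / ((U * W : ℕ) : ℝ) ^ k) x q p
      (r := 1 / ((U * W : ℕ) : ℝ) ^ k) (by positivity) (fun i => by
        obtain ⟨h3, h4⟩ := adicCube_child_subset z a hx i
        have h5 : (z i : ℝ) / ((U * W : ℕ) : ℝ) ^ k - x i =
            (z i - ((U * W : ℕ) : ℝ) ^ k * x i) / ((U * W : ℕ) : ℝ) ^ k := by
          field_simp
        rw [h5, abs_div, abs_of_pos hBk]
        gcongr
        rw [abs_le]; constructor <;> linarith)
    have h2 : (W : ℝ) ^ k * ‖affineForms x q p‖ ≤ ‖fun j => (q j : ℝ)‖ / (U : ℝ) ^ k := by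
      rw [le_div_iff₀ (by positivity)]
      have h3 : (b : ℝ) * ((W : ℝ) ^ k * ‖affineForms x q p‖) ≤ 1 := by
        refine le_trans ?_ hxp.le
        gcongr
      refine le_of_mul_le_mul_left ?_ (by linarith : (0 : ℝ) < b)
      calc (b : ℝ) * ((W : ℝ) ^ k * ‖affineForms x q p‖ * (U : ℝ) ^ k) =
            (b * ((W : ℝ) ^ k * ‖affineForms x q p‖)) * (U : ℝ) ^ k := by ring
        _ ≤ 1 * (U : ℝ) ^ k := by gcongr
        _ ≤ _ := by linarith
    calc _ ≤ (W : ℝ) ^ k * (n * (1 / ((U * W : ℕ) : ℝ) ^ k * ‖fun j => (q j : ℝ)‖) +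
          ‖affineForms x q p‖) := by gcongr
      _ = n * (‖fun j => (q j : ℝ)‖ / (U : ℝ) ^ k) + (W : ℝ) ^ k * ‖affineForms x q p‖ := by
        push_cast
        rw [mul_pow]
        field_simp
      _ ≤ _ := by linarith

open Classical in
/-- The bad subcubes of a good cube caused by vectors of a given length. -/
theorem card_bad_children_shell_le {m n b U W k : ℕ} (hn : 0 < n) (hb : 2 ≤ b)
    (hU : 0 < U) (hW : 0 < W) (hUW : W ^ m = U ^ n) {z : Fin m × Fin n → ℤ}
    (hz : IsLatticeGoodCube b U W k z)
    (V : (Fin m × Fin n → Fin (U * W)) → (Fin n ⊕ Fin m → ℤ)) (l : ℕ)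
    (A : Finset (Fin m × Fin n → Fin (U * W)))
    (hA : ∀ a ∈ A, (fun j => V a (Sum.inl j)) ≠ 0 ∧
      (b : ℝ) ^ l * (U : ℝ) ^ k ≤ b * ‖fun j => (V a (Sum.inl j) : ℝ)‖ ∧
      b * ‖fun j => (V a (Sum.inl j) : ℝ)‖ < (b : ℝ) ^ (l + 1) * (U : ℝ) ^ k ∧
      b * ‖fun j => (V a (Sum.inl j) : ℝ)‖ < (U : ℝ) ^ (k + 1) ∧
      (∃ x ∈ adicCube (U * W) (k + 1) (adicChild z a),
        ‖affineForms x (fun j => V a (Sum.inl j)) (fun i => V a (Sum.inr i))‖ ≤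
          1 / (b * (W : ℝ) ^ (k + 1))) ∧
      (W : ℝ) ^ k * ‖affineForms (fun i => (z i : ℝ) / ((U * W : ℕ) : ℝ) ^ k)
        (fun j => V a (Sum.inl j)) (fun i => V a (Sum.inr i))‖ ≤
          (n + 1) * (‖fun j => (V a (Sum.inl j) : ℝ)‖ / (U : ℝ) ^ k)) :
    (A.card : ℝ) ≤ ((2 * n + 3) * (((U * W : ℕ) : ℝ) ^ (n - 1) * (U / (b : ℝ) ^ l))) ^ m *
      (2 * ((n + 1) * (b : ℝ) ^ l + (4 * (b : ℝ)) ^ (n + m - 1))) ^ (n + m) := by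
  have hU0 : (0 : ℝ) < U := by exact_mod_cast hU
  have hW0 : (0 : ℝ) < W := by exact_mod_cast hW
  have hb0 : (0 : ℝ) < b := by exact_mod_cast (by omega : 0 < b)
  -- All vectors of the shell are counted in a single lattice, the one at the corner of the parent
  -- cube, where their length is at most `(n + 1) * b ^ l`.
  have hX : ((A.image V).card : ℝ) ≤
      (2 * ((n + 1) * (b : ℝ) ^ l + (4 * (b : ℝ)) ^ (n + m - 1))) ^ (n + m) := by
    refine card_integer_points_le (u := (U : ℝ) ^ k) (w := (W : ℝ) ^ k)
      (by positivity) (by positivity) hb0 (by positivity) ?_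
      (fun i => (z i : ℝ) / ((U * W : ℕ) : ℝ) ^ k) ?_ _ ?_
    · have : (W : ℝ) ^ m = (U : ℝ) ^ n := by exact_mod_cast hUW
      rw [← pow_mul, ← pow_mul, mul_comm k, mul_comm k, pow_mul, pow_mul, this]
    · refine hz _ fun i => ?_
      have hBk : (0 : ℝ) < ((U * W : ℕ) : ℝ) ^ k := by positivity
      rw [mul_div_cancel₀ _ hBk.ne']
      exact ⟨le_rfl, by linarith⟩
    · intro v hv
      obtain ⟨a, ha, rfl⟩ := Finset.mem_image.1 hv
      obtain ⟨-, -, h2, -, -, h4⟩ := hA a ha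
      have h5 : ‖fun j => (V a (Sum.inl j) : ℝ)‖ ≤ (b : ℝ) ^ l * (U : ℝ) ^ k := by
        refine le_of_mul_le_mul_left (h2.le.trans (le_of_eq ?_)) hb0
        ring
      constructor
      · have h6 : (0 : ℝ) ≤ n * ((b : ℝ) ^ l * (U : ℝ) ^ k) := by positivity
        linarith
      · refine h4.trans ?_
        gcongr
        rwa [div_le_iff₀ (by positivity)]
  set F : ℝ := ((2 * n + 3) * (((U * W : ℕ) : ℝ) ^ (n - 1) * (U / (b : ℝ) ^ l))) ^ m with hF
  have hF0 : 0 ≤ F := by positivity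
  have hfib : ∀ v ∈ A.image V, (A.filter fun a => V a = v).card ≤ ⌊F⌋₊ := by
    intro v hv
    obtain ⟨a₀, ha₀, rfl⟩ := Finset.mem_image.1 hv
    obtain ⟨hq, h1, -, h3, -, -⟩ := hA a₀ ha₀
    apply Nat.le_floor
    have hsub : (A.filter fun a => V a = V a₀) ⊆
        Finset.univ.filter fun a : Fin m × Fin n → Fin (U * W) =>
          ∃ x ∈ adicCube (U * W) (k + 1) (adicChild z a),
            ‖affineForms x (fun j => V a₀ (Sum.inl j)) (fun i => V a₀ (Sum.inr i))‖ ≤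
              1 / (b * (W : ℝ) ^ (k + 1)) := by
      intro a ha
      rw [Finset.mem_filter] at ha
      obtain ⟨ha, hV⟩ := ha
      have := (hA a ha).2.2.2.2.1
      rw [hV] at this
      exact Finset.mem_filter.2 ⟨Finset.mem_univ _, this⟩
    refine (Nat.cast_le.2 (Finset.card_le_card hsub)).trans
      ((card_children_small_value hn z _ hq _ (by positivity)).trans ?_)
    rw [hF]
    have hs : (0 : ℝ) < ‖fun j => (V a₀ (Sum.inl j) : ℝ)‖ :=
      one_pos.trans_le (one_le_norm_intCast hq)
    set s := ‖fun j => (V a₀ (Sum.inl j) : ℝ)‖ with hs_def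
    have e1 : ((U * W : ℕ) : ℝ) ^ (k + 1) * (1 / (b * (W : ℝ) ^ (k + 1)) / s) =
        (U : ℝ) ^ (k + 1) / (b * s) := by
      push_cast
      rw [mul_pow]
      field_simp
    have h6 : (U : ℝ) ^ (k + 1) / (b * s) ≤ U / (b : ℝ) ^ l := by
      rw [div_le_div_iff₀ (by positivity) (by positivity), pow_succ]
      calc (U : ℝ) ^ k * U * (b : ℝ) ^ l = U * ((b : ℝ) ^ l * (U : ℝ) ^ k) := by ring
        _ ≤ U * (b * s) := by gcongr
    -- The main term is at least 1, so the additive `2 n + 1` from digit rounding is absorbed,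
    -- giving the factor `2 n + 3`.
    have h7 : 1 ≤ (U : ℝ) ^ (k + 1) / (b * s) := by
      rw [one_le_div (by positivity)]; exact h3.le
    have h8 : 1 ≤ U / (b : ℝ) ^ l := h7.trans h6
    refine pow_le_pow_left₀ (by positivity) ?_ m
    rw [e1, mul_left_comm]
    gcongr
    have h9 : (n : ℝ) * 1 ≤ n * (U / (b : ℝ) ^ l) := by gcongr
    linarith
  have := Finset.card_le_mul_card_image (f := V) A ⌊F⌋₊ hfib
  calc (A.card : ℝ) ≤ (⌊F⌋₊ : ℝ) * ((A.image V).card : ℝ) := by exact_mod_cast this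
    _ ≤ F * (2 * ((n + 1) * (b : ℝ) ^ l + (4 * (b : ℝ)) ^ (n + m - 1))) ^ (n + m) :=
      mul_le_mul (Nat.floor_le hF0) hX (by positivity) hF0

/-- The vectors number at most a constant times `b ^ (d * max l (d - 1))` with `d = n + m`, while
each spoils a proportion of order `(W * b ^ l) ^ (-m)` of the children. The exponent `d ^ 2` in `U`
and `W` is large enough for a factor `b` to be gained in every shell. -/
theorem shell_contribution_le {m n b l : ℕ} (hm : 0 < m) (hn : 0 < n) (hb : 2 ≤ b)
    (hl : l < (n + m) ^ 2 * m) :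
    ((2 * n + 3) * (((b ^ ((n + m) ^ 2 * m) * b ^ ((n + m) ^ 2 * n) : ℕ) : ℝ) ^ (n - 1) *
      (((b ^ ((n + m) ^ 2 * m) : ℕ) : ℝ) / (b : ℝ) ^ l))) ^ m *
      (2 * ((n + 1) * (b : ℝ) ^ l + (4 * (b : ℝ)) ^ (n + m - 1))) ^ (n + m) ≤
    (2 * n + 3 : ℝ) ^ m * (2 * (n + 1) + 2 * 4 ^ (n + m - 1)) ^ (n + m) / b *
      ((b ^ ((n + m) ^ 2 * m) * b ^ ((n + m) ^ 2 * n) : ℕ) : ℝ) ^ (m * n) := by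
  have hb1 : (1 : ℝ) ≤ b := by exact_mod_cast (by omega : 1 ≤ b)
  have hb0 : (0 : ℝ) < b := by linarith
  set d := n + m with hd
  set U : ℝ := ((b ^ (d ^ 2 * m) : ℕ) : ℝ) with hU
  set W : ℝ := ((b ^ (d ^ 2 * n) : ℕ) : ℝ) with hW
  have hU' : U = (b : ℝ) ^ (d ^ 2 * m) := by rw [hU]; push_cast; rfl
  have hW' : W = (b : ℝ) ^ (d ^ 2 * n) := by rw [hW]; push_cast; rfl
  have hU0 : 0 < U := by rw [hU']; positivity
  have hW0 : 0 < W := by rw [hW']; positivity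
  rw [Nat.cast_mul, ← hU, ← hW]
  set M := max l (d - 1) with hM
  have h1 : 2 * ((n + 1) * (b : ℝ) ^ l + (4 * (b : ℝ)) ^ (d - 1)) ≤
      (2 * (n + 1) + 2 * 4 ^ (d - 1)) * (b : ℝ) ^ M := by
    have h2 : (b : ℝ) ^ l ≤ (b : ℝ) ^ M := pow_le_pow_right₀ hb1 (le_max_left _ _)
    have h3 : (b : ℝ) ^ (d - 1) ≤ (b : ℝ) ^ M := pow_le_pow_right₀ hb1 (le_max_right _ _)
    rw [mul_pow, add_mul, mul_add]
    have h4 : (2 : ℝ) * ((n + 1) * (b : ℝ) ^ l) ≤ 2 * (n + 1) * (b : ℝ) ^ M := by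
      rw [← mul_assoc]; gcongr
    have h5 : (2 : ℝ) * (4 ^ (d - 1) * (b : ℝ) ^ (d - 1)) ≤ 2 * 4 ^ (d - 1) * (b : ℝ) ^ M := by
      rw [← mul_assoc]; gcongr
    linarith
  -- For `l ≤ d - 1` the term `d ^ 2` already dominates. For larger `l`, `l * d = l * n + l * m` and
  -- the restriction `l < d ^ 2 * m` handles `l * n + 1`.
  have hexp : M * d + 1 ≤ d ^ 2 * n * m + l * m := by
    rcases le_total l (d - 1) with h | h
    · rw [hM, max_eq_right h]
      obtain ⟨e, he⟩ : ∃ e, d = e + 1 := ⟨d - 1, by omega⟩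
      have h6 : (d - 1) * d + 1 ≤ d ^ 2 := by
        rw [he, Nat.add_sub_cancel]; nlinarith
      have h7 : d ^ 2 * 1 ≤ d ^ 2 * (n * m) := Nat.mul_le_mul_left _ (Nat.mul_pos hn hm)
      nlinarith
    · rw [hM, max_eq_left h]
      have h6 : n * (l + 1) ≤ n * (d ^ 2 * m) := Nat.mul_le_mul_left _ hl
      have h7 : l * d = l * n + l * m := by rw [hd, mul_add]
      nlinarith
  have h8 : ((U * W) ^ (n - 1) * (U / (b : ℝ) ^ l)) ^ m =
      (U * W) ^ (m * n) / (b : ℝ) ^ (d ^ 2 * n * m + l * m) := by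
    have h9 : (U * W) ^ (n - 1) * (U / (b : ℝ) ^ l) = (U * W) ^ n / (W * (b : ℝ) ^ l) := by
      obtain ⟨e, rfl⟩ : ∃ e, n = e + 1 := ⟨n - 1, by omega⟩
      rw [Nat.add_sub_cancel, pow_succ]
      field_simp
    rw [h9, div_pow, ← pow_mul, mul_comm n m]
    congr 1
    rw [mul_pow, hW', ← pow_mul, ← pow_mul, ← pow_add]
  rw [mul_pow, h8]
  calc _ ≤ (2 * n + 3 : ℝ) ^ m * ((U * W) ^ (m * n) / (b : ℝ) ^ (d ^ 2 * n * m + l * m)) *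
        ((2 * (n + 1) + 2 * 4 ^ (d - 1)) * (b : ℝ) ^ M) ^ d := by gcongr
    _ = (2 * n + 3 : ℝ) ^ m * (2 * (n + 1) + 2 * 4 ^ (d - 1)) ^ d * (U * W) ^ (m * n) *
        ((b : ℝ) ^ (M * d) / (b : ℝ) ^ (d ^ 2 * n * m + l * m)) := by
      rw [mul_pow _ ((b : ℝ) ^ M), ← pow_mul]; ring
    _ ≤ (2 * n + 3 : ℝ) ^ m * (2 * (n + 1) + 2 * 4 ^ (d - 1)) ^ d * (U * W) ^ (m * n) *
        (1 / b) := by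
      refine mul_le_mul_of_nonneg_left ?_ (by positivity)
      rw [div_le_div_iff₀ (by positivity) hb0, ← pow_succ, one_mul]
      exact pow_le_pow_right₀ hb1 hexp
    _ = _ := by ring

-- For an offending vector, `b ‖q‖ / U ^ k` lies in `[1, U)`. As `U` is a fixed power of `b`, this
-- interval splits into a number of `b`-adic shells independent of `b`, each costing `O(1 / b)`.
open Classical in
theorem card_lattice_bad_children_le {m n b k : ℕ} (hm : 0 < m) (hn : 0 < n) (hb : 2 ≤ b)
    {z : Fin m × Fin n → ℤ}
    (hz : IsLatticeGoodCube b (b ^ ((n + m) ^ 2 * m)) (b ^ ((n + m) ^ 2 * n)) k z) :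
    ((Finset.univ.filter fun
        a : Fin m × Fin n → Fin (b ^ ((n + m) ^ 2 * m) * b ^ ((n + m) ^ 2 * n)) =>
      ¬ IsLatticeGoodCube b (b ^ ((n + m) ^ 2 * m)) (b ^ ((n + m) ^ 2 * n)) (k + 1)
        (adicChild z a)).card : ℝ) ≤
      ((n + m) ^ 2 * m : ℕ) *
        ((2 * n + 3 : ℝ) ^ m * (2 * (n + 1) + 2 * 4 ^ (n + m - 1)) ^ (n + m)) / b *
      ((b ^ ((n + m) ^ 2 * m) * b ^ ((n + m) ^ 2 * n) : ℕ) : ℝ) ^ (m * n) := by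
  have hb1 : (1 : ℝ) < b := by exact_mod_cast (by omega : 1 < b)
  have hpow : ∀ j, 0 < b ^ j := fun j => pow_pos (by omega) j
  have hviol := fun a =>
    exists_vector_of_bad_child hb (hpow ((n + m) ^ 2 * m)) (hpow ((n + m) ^ 2 * n)) hz a
  set s := (n + m) ^ 2 * m with hs
  set U := b ^ s with hU
  set W := b ^ ((n + m) ^ 2 * n) with hW
  set Bad' := Finset.univ.filter fun a : Fin m × Fin n → Fin (U * W) =>
    ¬ IsLatticeGoodCube b U W (k + 1) (adicChild z a) with hBad
  choose! V hV0 hVlow hVup hVx hVlat using hviol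
  let A : ℕ → Finset (Fin m × Fin n → Fin (U * W)) := fun l => Bad'.filter fun a =>
    (b : ℝ) ^ l * (U : ℝ) ^ k ≤ b * ‖fun j => (V a (Sum.inl j) : ℝ)‖ ∧
      b * ‖fun j => (V a (Sum.inl j) : ℝ)‖ < (b : ℝ) ^ (l + 1) * (U : ℝ) ^ k
  have hcover : Bad' ⊆ (Finset.range s).biUnion A := by
    intro a ha
    have ha' := (Finset.mem_filter.1 ha).2
    have hUk : (0 : ℝ) < (U : ℝ) ^ k := by
      have := hpow s; rw [← hU] at this; positivity
    obtain ⟨l, hl1, hl2⟩ := exists_nat_pow_near ((one_le_div hUk).2 (hVlow a ha')) hb1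
    rw [le_div_iff₀ hUk] at hl1
    rw [div_lt_iff₀ hUk] at hl2
    refine Finset.mem_biUnion.2 ⟨l, Finset.mem_range.2 ?_, Finset.mem_filter.2 ⟨ha, hl1, hl2⟩⟩
    have h1 : (b : ℝ) ^ l * (U : ℝ) ^ k < (b : ℝ) ^ s * (U : ℝ) ^ k := by
      refine (hl1.trans_lt (hVup a ha')).trans_le (le_of_eq ?_)
      rw [pow_succ, mul_comm, hU, Nat.cast_pow]
    exact (pow_lt_pow_iff_right₀ hb1).1 (lt_of_mul_lt_mul_right h1 hUk.le)
  have hUW : W ^ m = U ^ n := by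
    rw [hU, hW, hs, ← pow_mul, ← pow_mul]; congr 1; ring
  have hshell : ∀ l ∈ Finset.range s, ((A l).card : ℝ) ≤
      (2 * n + 3 : ℝ) ^ m * (2 * (n + 1) + 2 * 4 ^ (n + m - 1)) ^ (n + m) / b *
      ((U * W : ℕ) : ℝ) ^ (m * n) := by
    intro l hl
    refine (card_bad_children_shell_le hn hb (hpow _) (hpow _) hUW hz V l (A l) ?_).trans
      (shell_contribution_le hm hn hb (Finset.mem_range.1 hl))
    intro a ha
    obtain ⟨ha, h1, h2⟩ := Finset.mem_filter.1 ha
    have ha' := (Finset.mem_filter.1 ha).2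
    exact ⟨hV0 a ha', h1, h2, hVup a ha', hVx a ha', hVlat a ha'⟩
  calc (Bad'.card : ℝ) ≤ (((Finset.range s).biUnion A).card : ℝ) := by
        exact_mod_cast Finset.card_le_card hcover
    _ ≤ ∑ l ∈ Finset.range s, ((A l).card : ℝ) := by exact_mod_cast Finset.card_biUnion_le
    _ ≤ ∑ _l ∈ Finset.range s,
        (2 * n + 3 : ℝ) ^ m * (2 * (n + 1) + 2 * 4 ^ (n + m - 1)) ^ (n + m) / b *
          ((U * W : ℕ) : ℝ) ^ (m * n) := Finset.sum_le_sum hshell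
    _ = _ := by
      rw [Finset.sum_const, Finset.card_range, nsmul_eq_mul]; ring

/-- A point all of whose cubes are good is badly approximable. -/
theorem le_of_forall_isLatticeGoodCube {m n b U W : ℕ} (hb : 0 < b) (hU : 2 ≤ U)
    (hW : 0 < W) (hUW : W ^ m = U ^ n) {x : Fin m × Fin n → ℝ}
    (hx : ∀ k, ∃ z, IsLatticeGoodCube b U W k z ∧ x ∈ adicCube (U * W) k z) :
    x ∈ badMatrices m n (1 / ((b : ℝ) ^ (n + m) * (U : ℝ) ^ n)) := by
  classical
  intro q hq p
  have hU0 : (0 : ℝ) < U := by exact_mod_cast (by omega : 0 < U)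
  have hW0 : (0 : ℝ) < W := by exact_mod_cast hW
  have hb0 : (0 : ℝ) < b := by exact_mod_cast hb
  have hb1 : (1 : ℝ) ≤ b := by exact_mod_cast hb
  have hs := one_le_norm_intCast hq
  set s := ‖fun j => (q j : ℝ)‖
  -- Goodness is applied at the first level where the `q`-component is too short. Minimality gives
  -- `U ^ k ≤ b ‖q‖` one level earlier, which costs the factor `U ^ n` in the constant.
  have hex : ∃ k : ℕ, b * s < (U : ℝ) ^ k :=
    pow_unbounded_of_one_lt _ (by exact_mod_cast (by omega : 1 < U))
  obtain ⟨k, hk⟩ : ∃ k, Nat.find hex = k + 1 := by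
    refine Nat.exists_eq_succ_of_ne_zero fun h0 => ?_
    have := Nat.find_spec hex
    rw [h0, pow_zero] at this
    nlinarith
  have h1 := Nat.find_spec hex
  have h2 := not_lt.1 (Nat.find_min hex (m := k) (by omega))
  rw [hk] at h1
  obtain ⟨z, hz, hxz⟩ := hx (k + 1)
  have h3 := (hz x hxz q p (Or.inl hq)).resolve_left (not_le.2 h1)
  set t := ‖affineForms x q p‖
  have hUWr : (W : ℝ) ^ m = (U : ℝ) ^ n := by exact_mod_cast hUW
  rw [div_le_iff₀ (by positivity)]
  have h4 : 1 ≤ (b * (W ^ (k + 1) * t)) ^ m := one_le_pow₀ h3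
  have h5 : ((U : ℝ) ^ k) ^ n ≤ (b * s) ^ n := by gcongr
  have h6 : ((W : ℝ) ^ (k + 1)) ^ m = ((U : ℝ) ^ k) ^ n * (U : ℝ) ^ n := by
    rw [← pow_mul, mul_comm, pow_mul, hUWr, ← pow_mul, ← pow_mul, ← pow_add]
    congr 1; ring
  have h7 : (0 : ℝ) < ((U : ℝ) ^ k) ^ n := by positivity
  refine le_of_mul_le_mul_left ?_ h7
  calc ((U : ℝ) ^ k) ^ n * 1 ≤ (b * s) ^ n * (b * (W ^ (k + 1) * t)) ^ m :=
        mul_le_mul h5 h4 zero_le_one (by positivity)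
    _ = (b * s) ^ n * b ^ m * (((W : ℝ) ^ (k + 1)) ^ m) * t ^ m := by
      rw [mul_pow (b : ℝ) ((W : ℝ) ^ (k + 1) * t), mul_pow ((W : ℝ) ^ (k + 1))]; ring
    _ = _ := by rw [h6, mul_pow, pow_add]; ring

/-- The true subdivision base is `U * W`, a power of `b`. Replacing its logarithm by `log b` only
weakens the constant. -/
theorem le_dimH_badMatrices {m n : ℕ} (hm : 0 < m) (hn : 0 < n) :
    ∃ (C : ℝ) (b₀ : ℕ), ∀ b : ℕ, b₀ ≤ b →
      ENNReal.ofReal ((m : ℝ) * n - C / (b * Real.log b)) ≤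
        dimH (badMatrices m n (1 / (b : ℝ) ^ (n + m + (n + m) ^ 2 * m * n))) := by
  classical
  set C : ℝ := ((n + m) ^ 2 * m : ℕ) *
    ((2 * n + 3 : ℝ) ^ m * (2 * (n + 1) + 2 * 4 ^ (n + m - 1)) ^ (n + m)) with hC
  have hC0 : 0 ≤ C := by positivity
  refine ⟨2 * C, ⌈2 * C⌉₊ + 4, fun b hb => ?_⟩
  have hb4 : 4 ≤ b := by omega
  have hbC : 2 * C ≤ b := (Nat.le_ceil _).trans (by exact_mod_cast (by omega : ⌈2 * C⌉₊ ≤ b))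
  have hb0 : (0 : ℝ) < b := by exact_mod_cast (by omega : 0 < b)
  have hb1 : (1 : ℝ) < b := by exact_mod_cast (by omega : 1 < b)
  have hpow : ∀ j, 0 < b ^ j := fun j => pow_pos (by omega) j
  have hexp : ∀ j, 0 < j → b ≤ b ^ ((n + m) ^ 2 * j) := fun j hj =>
    Nat.le_self_pow (by positivity) b
  set U := b ^ ((n + m) ^ 2 * m) with hU
  set W := b ^ ((n + m) ^ 2 * n) with hW
  have hbUW : b ≤ U * W :=
    (hexp m hm).trans (Nat.le_mul_of_pos_right _ (hpow _))
  have : Nonempty (Fin m × Fin n) := ⟨(⟨0, hm⟩, ⟨0, hn⟩)⟩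
  have hG0 : IsLatticeGoodCube b U W 0 (0 : Fin m × Fin n → ℤ) := by
    intro x _ q p hqp
    rw [pow_zero, pow_zero, one_mul]
    by_cases hq : q = 0
    · right
      subst hq
      rw [affineForms_zero_left]
      have := one_le_norm_intCast (hqp.resolve_left (not_not.2 rfl))
      nlinarith
    · left
      have := one_le_norm_intCast hq
      nlinarith
  have key := le_dimH_of_sparse_tree (δ := C / b) (hb4.trans hbUW) (by positivity)
    (by rw [div_le_div_iff₀ hb0 (by norm_num)]; linarith) (IsLatticeGoodCube b U W) 0 hG0
    (fun k z hz => by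
      rw [Fintype.card_prod, Fintype.card_fin, Fintype.card_fin]
      exact card_lattice_bad_children_le hm hn (by omega) hz)
  refine le_trans (ENNReal.ofReal_le_ofReal ?_) (key.trans (dimH_mono ?_))
  · rw [Fintype.card_prod, Fintype.card_fin, Fintype.card_fin, Nat.cast_mul]
    have hlog : 0 < Real.log b := Real.log_pos hb1
    have h1 : Real.log b ≤ Real.log ((U * W : ℕ) : ℝ) :=
      Real.log_le_log hb0 (by exact_mod_cast hbUW)
    rw [mul_div_assoc', div_div]
    gcongr
  · intro x hx
    have := le_of_forall_isLatticeGoodCube (by omega) ((by omega : 2 ≤ b).trans (hexp m hm))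
      (hpow _) (by rw [← pow_mul, ← pow_mul]; congr 1; ring) hx
    rw [Nat.cast_pow, ← pow_mul, ← pow_add] at this
    exact this

/-! ### Passage to matrices, arbitrary norms and all `c`. -/

/-- `Bad` for the supremum norms. -/
def supBad (m n : ℕ) (c : ℝ) : Set (Matrix (Fin m) (Fin n) ℝ) :=
  {A | ∀ q : Fin n → ℤ, q ≠ 0 → ∀ p : Fin m → ℤ,
    c ≤ ‖fun j => (q j : ℝ)‖ ^ n * ‖A *ᵥ (fun j => (q j : ℝ)) - fun i => (p i : ℝ)‖ ^ m}

theorem dimH_le_of_linearEquiv {E F : Type*} [NormedAddCommGroup E] [NormedSpace ℝ E]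
    [FiniteDimensional ℝ E] [NormedAddCommGroup F] [NormedSpace ℝ F] (e : E ≃ₗ[ℝ] F) {S : Set E}
    {T : Set F} (h : ∀ x ∈ S, e x ∈ T) : dimH S ≤ dimH T := by
  rw [← e.toContinuousLinearEquiv.dimH_image S]
  refine dimH_mono ?_
  rintro _ ⟨x, hx, rfl⟩
  exact h x hx

theorem norm_fin_one (v : Fin 1 → ℝ) : ‖v‖ = |v 0| := by
  have : v = fun _ => v 0 := funext fun i => by rw [Subsingleton.elim i 0]
  rw [this, pi_norm_const, Real.norm_eq_abs]

/-- Column vectors as matrices. -/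
def columnEquiv (m : ℕ) : (Fin m → ℝ) ≃ₗ[ℝ] Matrix (Fin m) (Fin 1) ℝ where
  toFun x := Matrix.of fun i _ => x i
  map_add' _ _ := rfl
  map_smul' _ _ := rfl
  invFun A i := A i 0
  left_inv _ := rfl
  right_inv A := by
    ext i j
    rw [Subsingleton.elim j 0]
    rfl

theorem columnEquiv_apply {m : ℕ} (x : Fin m → ℝ) (i : Fin m) (j : Fin 1) :
    columnEquiv m x i j = x i := rfl

/-- Row vectors as matrices. -/
def rowEquiv (n : ℕ) : (Fin n → ℝ) ≃ₗ[ℝ] Matrix (Fin 1) (Fin n) ℝ where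
  toFun x := Matrix.of fun _ j => x j
  map_add' _ _ := rfl
  map_smul' _ _ := rfl
  invFun A j := A 0 j
  left_inv _ := rfl
  right_inv A := by
    ext i j
    rw [Subsingleton.elim i 0]
    rfl

theorem rowEquiv_apply {n : ℕ} (x : Fin n → ℝ) (i : Fin 1) (j : Fin n) :
    rowEquiv n x i j = x j := rfl

/-- Functions of two variables as matrices. -/
def uncurriedEquiv (m n : ℕ) : (Fin m × Fin n → ℝ) ≃ₗ[ℝ] Matrix (Fin m) (Fin n) ℝ where
  toFun x := Matrix.of fun i j => x (i, j)
  map_add' _ _ := rfl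
  map_smul' _ _ := rfl
  invFun A i := A i.1 i.2
  left_inv _ := rfl
  right_inv _ := rfl

theorem dimH_badVectors_le (m : ℕ) (c : ℝ) : dimH (badVectors m c) ≤ dimH (supBad m 1 c) := by
  refine dimH_le_of_linearEquiv (columnEquiv m) fun x hx q hq p => ?_
  have hq0 : q 0 ≠ 0 := fun h => hq (funext fun i => by rw [Subsingleton.elim i 0]; exact h)
  refine (hx (q 0) hq0 p).trans (le_of_eq ?_)
  rw [norm_fin_one, pow_one]
  congr 3
  funext i
  simp [Matrix.mulVec, dotProduct, mul_comm, columnEquiv_apply]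

theorem dimH_badForms_le (n : ℕ) (c : ℝ) : dimH (badForms n c) ≤ dimH (supBad 1 n c) := by
  refine dimH_le_of_linearEquiv (rowEquiv n) fun x hx q hq p => ?_
  refine (hx q hq (p 0)).trans (le_of_eq ?_)
  rw [norm_fin_one, pow_one]
  simp [Matrix.mulVec, dotProduct, mul_comm, rowEquiv_apply]

theorem dimH_badMatrices_le (m n : ℕ) (c : ℝ) :
    dimH (badMatrices m n c) ≤ dimH (supBad m n c) := by
  refine dimH_le_of_linearEquiv (uncurriedEquiv m n) fun x hx q hq p => ?_
  exact hx q hq p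

/-- The dimension estimate for `supBad m n (κ / b ^ e)` along integers `b`. -/
def HasDimEstimate (m n e : ℕ) : Prop :=
  ∃ (κ C : ℝ) (b₀ : ℕ), 0 < κ ∧ ∀ b : ℕ, b₀ ≤ b →
    ENNReal.ofReal ((m : ℝ) * n - C / (b * Real.log b)) ≤ dimH (supBad m n (κ / (b : ℝ) ^ e))

theorem hasDimEstimate_column {m : ℕ} (hm : 0 < m) : HasDimEstimate m 1 (2 * m) := by
  obtain ⟨C, b₀, h⟩ := le_dimH_badVectors hm
  refine ⟨1, C, b₀, one_pos, fun b hb => ?_⟩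
  rw [Nat.cast_one, mul_one]
  exact (h b hb).trans (dimH_badVectors_le m _)

/-- Transference raises `b ^ (-2n)` to the power `n`, and its constant becomes `κ`. -/
theorem hasDimEstimate_row {n : ℕ} (hn : 0 < n) : HasDimEstimate 1 n (2 * n ^ 2) := by
  obtain ⟨C, b₀, h⟩ := le_dimH_badVectors hn
  have hn0 : (0 : ℝ) < n := by exact_mod_cast hn
  refine ⟨1 / (2 * (4 * (n : ℝ) ^ n) ^ n), C, b₀ + 1, by positivity, fun b hb => ?_⟩
  have hb1 : (1 : ℝ) ≤ b := by exact_mod_cast (by omega : 1 ≤ b)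
  rw [Nat.cast_one, one_mul]
  refine (h b (by omega)).trans ((dimH_mono (badVectors_subset_badForms hn (by positivity)
    ?_)).trans ((dimH_badForms_le n _).trans (le_of_eq ?_)))
  · rw [div_le_one (by positivity)]
    exact one_le_pow₀ hb1
  · congr 2
    rw [div_pow, one_pow, ← pow_mul, div_div, div_div, mul_comm (2 * (4 * (n : ℝ) ^ n) ^ n)]
    congr 3
    ring

theorem hasDimEstimate_general {m n : ℕ} (hm : 0 < m) (hn : 0 < n) :
    HasDimEstimate m n (n + m + (n + m) ^ 2 * m * n) := by
  obtain ⟨C, b₀, h⟩ := le_dimH_badMatrices hm hn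
  exact ⟨1, C, b₀, one_pos, fun b hb => (h b hb).trans (dimH_badMatrices_le m n _)⟩

theorem exists_le_seminorm {n : ℕ} (N : Seminorm ℝ (Fin n → ℝ)) (hN : IsNorm N) :
    ∃ a : ℝ, 0 < a ∧ ∀ x, a * ‖x‖ ≤ N x := by
  have hcont : Continuous N := N.convexOn.locallyLipschitz.continuous
  rcases (Metric.sphere (0 : Fin n → ℝ) 1).eq_empty_or_nonempty with hS | hS
  · refine ⟨1, one_pos, fun x => ?_⟩
    have hx : x = 0 := by
      by_contra hx
      refine (eq_empty_iff_forall_notMem.1 hS) (‖x‖⁻¹ • x) ?_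
      rw [mem_sphere_zero_iff_norm, norm_smul, norm_inv, norm_norm,
        inv_mul_cancel₀ (norm_ne_zero_iff.2 hx)]
    rw [hx, norm_zero, mul_zero]
    exact apply_nonneg N 0
  · obtain ⟨u, hu, hmin⟩ :=
      (isCompact_sphere (0 : Fin n → ℝ) 1).exists_isMinOn hS hcont.continuousOn
    have hu1 : ‖u‖ = 1 := mem_sphere_zero_iff_norm.1 hu
    refine ⟨N u, lt_of_le_of_ne (apply_nonneg N u) fun h => ?_, fun x => ?_⟩
    · rw [hN u h.symm, norm_zero] at hu1
      exact zero_ne_one hu1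
    · rcases eq_or_ne x 0 with rfl | hx
      · rw [norm_zero, mul_zero]
        exact apply_nonneg N 0
      · have hx0 : 0 < ‖x‖ := norm_pos_iff.2 hx
        have h1 : N u ≤ N (‖x‖⁻¹ • x) := hmin (by
          rw [mem_sphere_zero_iff_norm, norm_smul, norm_inv, norm_norm, inv_mul_cancel₀ hx0.ne'])
        rw [map_smul_eq_mul, norm_inv, norm_norm, inv_mul_eq_div, le_div_iff₀ hx0] at h1
        exact h1

/-- Lower bounds for the dimension of `supBad` give the bound for all norms and all `c`. -/
theorem HasDimEstimate.codim_le {m n e : ℕ} (he : 0 < e) (h : HasDimEstimate m n e)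
    (N : Seminorm ℝ (Fin n → ℝ)) (M : Seminorm ℝ (Fin m → ℝ)) (hN : IsNorm N) (hM : IsNorm M) :
    ∃ k₁ : ℝ, 0 < k₁ ∧ ∀ c : ℝ, 0 < c → c < 1 →
      hausdorffCodim (Bad m n N M c) ≤ k₁ * (c ^ (1 / (e : ℝ)) / Real.log (1 / c)) := by
  obtain ⟨κ, C, b₀, hκ, hdim⟩ := h
  obtain ⟨aN, haN, hNle⟩ := exists_le_seminorm N hN
  obtain ⟨aM, haM, hMle⟩ := exists_le_seminorm M hM
  have hsub : ∀ c c' : ℝ, c ≤ aN ^ n * aM ^ m * c' → supBad m n c' ⊆ Bad m n N M c := by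
    intro c c' hcc A hA q hq p
    have h1 := hA q hq p
    calc c ≤ aN ^ n * aM ^ m * c' := hcc
      _ ≤ aN ^ n * aM ^ m * (‖fun j => (q j : ℝ)‖ ^ n *
          ‖A *ᵥ (fun j => (q j : ℝ)) - fun i => (p i : ℝ)‖ ^ m) := by gcongr
      _ = (aN * ‖fun j => (q j : ℝ)‖) ^ n *
          (aM * ‖A *ᵥ (fun j => (q j : ℝ)) - fun i => (p i : ℝ)‖) ^ m := by
        rw [mul_pow, mul_pow]; ring
      _ ≤ _ := by gcongr <;> [exact hNle _; exact hMle _]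
  have hcod : ∀ (S : Set (Matrix (Fin m) (Fin n) ℝ)) (t : ℝ),
      ENNReal.ofReal ((m : ℝ) * n - t) ≤ dimH S → hausdorffCodim S ≤ t := by
    intro S t ht
    have hfin : dimH S ≠ ⊤ := by
      refine ne_top_of_le_ne_top ?_ (dimH_mono (subset_univ S))
      rw [Real.dimH_univ_eq_finrank]
      exact ENNReal.natCast_ne_top _
    have h1 := (ENNReal.ofReal_le_iff_le_toReal hfin).1 ht
    rw [hausdorffCodim, Module.finrank_matrix, Module.finrank_self, Fintype.card_fin,
      Fintype.card_fin]
    push_cast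
    linarith
  set l := aN ^ n * aM ^ m * κ with hl
  have hl0 : 0 < l := by positivity
  have he0 : (0 : ℝ) < e := by exact_mod_cast he
  set b₁ : ℕ := b₀ + 2 with hb₁
  -- The three bounds give `c₁ < 1`, then `b ≥ b₁` for the integer `b` chosen below, then `y / 2 ≥ c
  -- ^ (-1 / (2 e))`, which compares `log b` with `log (1 / c)`.
  set c₁ : ℝ := min (1 / 2) (min (l / (b₁ : ℝ) ^ e) ((l / 2 ^ e) ^ 2)) with hc₁
  have hb₁0 : (0 : ℝ) < b₁ := by exact_mod_cast (by omega : 0 < b₁)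
  have hc₁0 : 0 < c₁ := by positivity
  have hc₁1 : c₁ < 1 := (min_le_left _ _).trans_lt (by norm_num)
  have hlogc₁ : 0 < Real.log (1 / c₁) := Real.log_pos (by rw [one_lt_div hc₁0]; exact hc₁1)
  set K₁ : ℝ := (m : ℝ) * n * (Real.log (1 / c₁) / c₁ ^ (1 / (e : ℝ))) with hK₁
  set K₂ : ℝ := |C| * (4 * e / l ^ (1 / (e : ℝ))) with hK₂
  have hK₁0 : 0 ≤ K₁ := by positivity
  have hK₂0 : 0 ≤ K₂ := by positivity
  refine ⟨K₁ + K₂ + 1, by positivity, fun c hc0 hc1 => ?_⟩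
  have hlogc : 0 < Real.log (1 / c) := Real.log_pos (by rw [one_lt_div hc0]; exact hc1)
  have hX : 0 ≤ c ^ (1 / (e : ℝ)) / Real.log (1 / c) := by positivity
  -- For `c ≥ c₁` the trivial codimension bound `m n` suffices, because `c ^ (1 / e) / log (1 / c)`
  -- increases with `c`.
  rcases le_total c₁ c with hle | hle
  · have h1 : hausdorffCodim (Bad m n N M c) ≤ (m : ℝ) * n := hcod _ _ (by simp)
    have h2 : c₁ ^ (1 / (e : ℝ)) / Real.log (1 / c₁) ≤ c ^ (1 / (e : ℝ)) / Real.log (1 / c) := by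
      gcongr
    have h3 : (m : ℝ) * n = K₁ * (c₁ ^ (1 / (e : ℝ)) / Real.log (1 / c₁)) := by
      have : 0 < c₁ ^ (1 / (e : ℝ)) := by positivity
      rw [hK₁]; field_simp
    calc _ ≤ (m : ℝ) * n := h1
      _ = K₁ * (c₁ ^ (1 / (e : ℝ)) / Real.log (1 / c₁)) := h3
      _ ≤ K₁ * (c ^ (1 / (e : ℝ)) / Real.log (1 / c)) := by gcongr
      _ ≤ _ := by gcongr; linarith
  · have hcl : c ≤ l / (b₁ : ℝ) ^ e := hle.trans ((min_le_right _ _).trans (min_le_left _ _))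
    have hcl2 : c ≤ (l / 2 ^ e) ^ 2 := hle.trans ((min_le_right _ _).trans (min_le_right _ _))
    -- At the real number `y` the constant `l / y ^ e` equals `c`. Rounding down to `b` keeps `c ≤ l
    -- / b ^ e` and loses at most a factor 2 in size.
    set y : ℝ := (l / c) ^ (1 / (e : ℝ)) with hy
    have hy0 : 0 < y := by positivity
    have hye : y ^ e = l / c := by
      rw [hy, one_div, Real.rpow_inv_natCast_pow (by positivity) he.ne']
    have hby : (b₁ : ℝ) ≤ y := by
      refine le_of_pow_le_pow_left₀ he.ne' hy0.le ?_
      rw [hye, le_div_iff₀ hc0, mul_comm]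
      rwa [le_div_iff₀ (by positivity)] at hcl
    set b := ⌊y⌋₊ with hb
    have hbb₁ : b₁ ≤ b := Nat.le_floor hby
    have hb_le : (b : ℝ) ≤ y := Nat.floor_le hy0.le
    have hb2 : (2 : ℝ) ≤ b := by exact_mod_cast (by omega : 2 ≤ b)
    have hb0 : (0 : ℝ) < b := by linarith
    have hb_ge : y / 2 ≤ b := by
      have := Nat.lt_floor_add_one y
      rw [← hb] at this
      linarith
    have h1 : hausdorffCodim (Bad m n N M c) ≤ C / (b * Real.log b) := by
      refine hcod _ _ ((hdim b (by omega)).trans (dimH_mono (hsub _ _ ?_)))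
      rw [← mul_div_assoc, ← hl, le_div_iff₀ (by positivity)]
      have : (b : ℝ) ^ e ≤ l / c := by rw [← hye]; gcongr
      rw [le_div_iff₀ hc0] at this
      linarith
    have hlogb : Real.log (1 / c) / (2 * e) ≤ Real.log b := by
      have h2 : Real.log (y / 2) ≤ Real.log b := Real.log_le_log (by positivity) hb_ge
      refine le_trans ?_ h2
      have h3 : Real.log y = (Real.log l + Real.log (1 / c)) / e := by
        rw [hy, Real.log_rpow (by positivity), div_eq_mul_one_div l c,
          Real.log_mul hl0.ne' (by positivity)]
        ring
      have h4 : Real.log c ≤ 2 * (Real.log l - e * Real.log 2) := by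
        have := Real.log_le_log hc0 hcl2
        rwa [Real.log_pow, Real.log_div hl0.ne' (by positivity), Real.log_pow] at this
      rw [Real.log_div hy0.ne' (by norm_num), h3]
      have h5 : Real.log (1 / c) = -Real.log c := by rw [one_div, Real.log_inv]
      rw [h5]
      rw [div_le_iff₀ (by positivity)]
      have h6 : ((Real.log l + -Real.log c) / e - Real.log 2) * (2 * e) =
          2 * (Real.log l - Real.log c - e * Real.log 2) := by
        field_simp; ring
      rw [h6]
      linarith
    have hlogb0 : 0 < Real.log b := Real.log_pos (by linarith)
    have h7 : y * c ^ (1 / (e : ℝ)) = l ^ (1 / (e : ℝ)) := by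
      rw [hy, ← Real.mul_rpow (by positivity) hc0.le, div_mul_cancel₀ _ hc0.ne']
    have hcp : 0 < c ^ (1 / (e : ℝ)) := by positivity
    have h8 : C / (b * Real.log b) ≤ |C| / (y / 2 * (Real.log (1 / c) / (2 * e))) := by
      calc C / (b * Real.log b) ≤ |C| / (b * Real.log b) := by gcongr; exact le_abs_self C
        _ ≤ _ := by gcongr
    have h9 : |C| / (y / 2 * (Real.log (1 / c) / (2 * e))) =
        K₂ * (c ^ (1 / (e : ℝ)) / Real.log (1 / c)) := by
      rw [hK₂, ← h7]; field_simp; norm_num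
    calc _ ≤ C / (b * Real.log b) := h1
      _ ≤ K₂ * (c ^ (1 / (e : ℝ)) / Real.log (1 / c)) := h8.trans h9.le
      _ ≤ _ := by gcongr; linarith

theorem theorem1p1 :
    ∃ p : ℕ → ℕ → ℝ,
      (∀ m : ℕ, 0 < m → p m 1 = 2 * (m : ℝ)) ∧
      (∀ n : ℕ, 0 < n → p 1 n = 2 * (n : ℝ) ^ 2) ∧
      ∀ m n : ℕ, 0 < m → 0 < n →
        0 < p m n ∧
        ∀ (N : Seminorm ℝ (Fin n → ℝ)) (M : Seminorm ℝ (Fin m → ℝ)),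
          IsNorm N → IsNorm M →
          ∃ k₁ : ℝ, 0 < k₁ ∧ ∀ c : ℝ, 0 < c → c < 1 →
            hausdorffCodim (Bad m n N M c) ≤ k₁ * (c ^ (1 / p m n) / Real.log (1 / c)) := by
  -- For `m = n = 1` the two special exponents agree, both being 2, so the order of the tests is
  -- harmless.
  let e : ℕ → ℕ → ℕ := fun m n =>
    if n = 1 then 2 * m else if m = 1 then 2 * n ^ 2 else n + m + (n + m) ^ 2 * m * n
  have he : ∀ m n, 0 < m → 0 < n → 0 < e m n ∧ HasDimEstimate m n (e m n) := by
    intro m n hm hn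
    simp only [e]
    split_ifs with h1 h2
    · subst h1; exact ⟨by omega, hasDimEstimate_column hm⟩
    · subst h2; exact ⟨by positivity, hasDimEstimate_row hn⟩
    · exact ⟨by omega, hasDimEstimate_general hm hn⟩
  refine ⟨fun m n => e m n, fun m _ => by simp [e], fun n _ => ?_, fun m n hm hn => ?_⟩
  · by_cases h : n = 1
    · subst h; simp [e]
    · simp [e, h]
  · obtain ⟨h0, h⟩ := he m n hm hn
    exact ⟨Nat.cast_pos.2 h0, fun N M hN hM => h.codim_le h0 N M hN hM⟩
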